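/- Let $R\ge 1$ and $L\ge 2$, let $u_1,\dots,u_{2R}$ be integers, and let $D=\mathrm{diag}\big(e^{2\pi \mathrm{j} u_1/L},\dots,e^{2\pi \mathrm{j} u_{2R}/L}\big)$, $\mathrm{j}=\sqrt{-1}$, be the generator of the cyclic group used at the source. Let $M$ be an $R\times R$ complex matrix with all entries of modulus one and $MM^H=M^HM=R\,I_R$, let $\Gamma=\begin{bmatrix}M\\ M\end{bmatrix}$, $x=\frac1{\sqrt{2R}}(1,\dots,1)^T\in\mathbb C^{2R}$, and let $A_j=\mathrm{diag}(\Gamma_{1j},\dots,\Gamma_{2R,j})$ for $j=1,\dots,R$. The codewords are $S_k=[A_1D^kx\ \cdots\ A_RD^kx]=\frac1{\sqrt{2R}}D^k\Gamma$, $k=1,\dots,L$. A source communicates with a destination through $R$ relays. For a message $k$, uniformly distributed on $\{1,\dots,L\}$, the source sends $s=D^kx$, relay $j$ receives $r_j=\sqrt{2RP_1}\,f_j s+n_j$ and transmits $t_j=\sqrt{P_2/(1+P_1)}\,A_jr_j$, and the destination receives $y=\sum_{j=1}^R g_jt_j+w$. Here $f_j,g_j$ and all coordinates of $n_j,w\in\mathbb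 C^{2R}$ are independent circularly symmetric complex Gaussian variables with mean $0$ and variance $1$, independent of the message. The total power is $P=P_1+RP_2$, split in fixed proportions: $P_1=\alpha P$ and $P_2=(1-\alpha)P/R$ with $0<\alpha<1$. The destination knows $g=(g_1,\dots,g_R)$ but not the $f_j$, and uses a maximum likelihood decoder: it outputs, as a measurable function of $(g,y)$, a message $\hat k$ that maximizes the conditional density of $y$ given $(S_k,g)$, ties being broken arbitrarily. The network has diversity order $d$ if the block error probability $P_e(P)=\Pr[\hat k\ne k]$ satisfies $\lim_{P\to\infty}-\log P_e(P)/\log P=d$. Then the network has diversity order $R$ if and only if $$\gcd(u_i-u_{R+i},\,L)=1\qquad\text{for each } i=1,\dots,R .$$ The same condition is also necessary and sufficient for the determinant criterion for full diversity: $\det\big([S_n\ S_m]^H[S_n\ S_m]\big)\neq0$ for all $n\ne m$ in $\{1,\dots,L\}$. -/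

import Mathlib

open scoped Matrix

namespace RelayNetwork

noncomputable section

/-- The index set `{1, …, 2R}` of the `T = 2R` channel uses, split into its two halves:
`Sum.inl i` is the position `i` and `Sum.inr i` is the position `R + i`, for `i : Fin R`. -/
abbrev Slot (R : ℕ) : Type := Fin R ⊕ Fin R

/-! ### The code -/

/-- Generalized Butson-Hadamard matrices of size `R`. -/
structure IsGBH {R : ℕ} (M : Matrix (Fin R) (Fin R) ℂ) : Prop where
  mul_conjTranspose : M * Mᴴ = (R : ℂ) • (1 : Matrix (Fin R) (Fin R) ℂ)
  conjTranspose_mul : Mᴴ * M = (R : ℂ) • (1 : Matrix (Fin R) (Fin R) ℂ)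
  star_mul_self : ∀ i j, star (M i j) * M i j = 1

/-- The generator `D = diag (exp (2 π √-1 u_i / L))` of the cyclic group at the source. -/
def generator {R : ℕ} (L : ℕ) (u : Slot R → ℤ) : Matrix (Slot R) (Slot R) ℂ :=
  Matrix.diagonal fun i => Complex.exp (2 * Real.pi * Complex.I * (u i : ℂ) / (L : ℂ))

/-- The vector `x = (2R)^{-1/2} (1, …, 1)`. -/
def initialVector (R : ℕ) : Slot R → ℂ := fun _ => ((1 / Real.sqrt (2 * R) : ℝ) : ℂ)

/-- The `2R × R` matrix `Γ` whose upper and lower halves are both `M`. -/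
def stacked {R : ℕ} (M : Matrix (Fin R) (Fin R) ℂ) : Matrix (Slot R) (Fin R) ℂ :=
  Matrix.fromRows M M

/-- The diagonal matrix `A_j` of the `j`-th relay, built from the `j`-th column of `Γ`. -/
def relayMatrix {R : ℕ} (M : Matrix (Fin R) (Fin R) ℂ) (j : Fin R) :
    Matrix (Slot R) (Slot R) ℂ :=
  Matrix.diagonal fun i => stacked M i j

/-- The vector `D^k x` sent by the source for the message `k`. The messages `0, …, L - 1` of
`Fin L` stand for the exponents `1, …, L`. -/
def sourceVector {R L : ℕ} (u : Slot R → ℤ) (k : Fin L) : Slot R → ℂ :=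
  (generator L u ^ ((k : ℕ) + 1)) *ᵥ initialVector R

/-- The codeword matrix `S_k = [A_1 D^k x  …  A_R D^k x]`. -/
def codeword {R L : ℕ} (u : Slot R → ℤ) (M : Matrix (Fin R) (Fin R) ℂ) (k : Fin L) :
    Matrix (Slot R) (Fin R) ℂ :=
  Matrix.of fun i j => (relayMatrix M j *ᵥ sourceVector u k) i

/-- The design criterion: `|S_{nm}ᴴ S_{nm}| ≠ 0` for all `n ≠ m`, with `S_{nm} = [S_n  S_m]`. -/
def MeetsDeterminantCriterion {R L : ℕ} (S : Fin L → Matrix (Slot R) (Fin R) ℂ) : Prop :=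
  ∀ n m : Fin L, n ≠ m →
    ((Matrix.fromCols (S n) (S m))ᴴ * Matrix.fromCols (S n) (S m)).det ≠ 0

/-! ### The channel -/

/-- The circularly symmetric complex Gaussian law with mean `0` and variance `1`. -/
def cscg : MeasureTheory.Measure ℂ :=
  MeasureTheory.volume.withDensity fun z => ENNReal.ofReal (Real.pi⁻¹ * Real.exp (-‖z‖ ^ 2))

instance : MeasureTheory.IsProbabilityMeasure cscg := by
  constructor
  have h : ∫ z : ℂ, Real.exp (-1 * ‖z‖ ^ 2) = Real.pi := by
    have := GaussianFourier.integral_rexp_neg_mul_sq_norm (V := ℂ) (b := 1) one_pos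
    simpa [Complex.finrank_real_complex] using this
  have hi : MeasureTheory.Integrable (fun z : ℂ => Real.exp (-1 * ‖z‖ ^ 2)) := by
    by_contra hn
    rw [MeasureTheory.integral_undef hn] at h
    exact Real.pi_ne_zero h.symm
  rw [cscg, MeasureTheory.withDensity_apply _ MeasurableSet.univ,
    MeasureTheory.Measure.restrict_univ,
    ← MeasureTheory.ofReal_integral_eq_lintegral_ofReal]
  · rw [MeasureTheory.integral_const_mul]
    simp only [neg_mul, one_mul] at h
    rw [h, inv_mul_cancel₀ Real.pi_ne_zero, ENNReal.ofReal_one]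
  · simpa using hi.const_mul Real.pi⁻¹
  · exact Filter.Eventually.of_forall fun z => by positivity

/-- One realization `(f, g, n, w)` of the randomness in the network: the fading coefficients
`f_j` (source to relays) and `g_j` (relays to destination), the noise vectors `n_j` at the relays
and the noise vector `w` at the destination. -/
abbrev Realization (R : ℕ) : Type :=
  (Fin R → ℂ) × (Fin R → ℂ) × (Fin R → Slot R → ℂ) × (Slot R → ℂ)

/-- All coordinates of `f, g, n, w` are independent with law `cscg`. -/
def channelLaw (R : ℕ) : MeasureTheory.Measure (Realization R) :=
  (MeasureTheory.Measure.pi fun _ => cscg).prod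
    ((MeasureTheory.Measure.pi fun _ => cscg).prod
      ((MeasureTheory.Measure.pi fun _ => MeasureTheory.Measure.pi fun _ => cscg).prod
        (MeasureTheory.Measure.pi fun _ => cscg)))

/-- The vector `r_j = √(P₁ T) f_j s + n_j` received by the `j`-th relay, with `T = 2R`. -/
def relayReceived {R : ℕ} (P₁ : ℝ) (s : Slot R → ℂ) (f : Fin R → ℂ) (n : Fin R → Slot R → ℂ)
    (j : Fin R) : Slot R → ℂ :=
  ((Real.sqrt (P₁ * (2 * R)) : ℂ) * f j) • s + n j

/-- The vector `t_j = √(P₂ / (1 + P₁)) A_j r_j` transmitted by a relay with matrix `A_j`. -/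
def relayTransmitted {R : ℕ} (P₁ P₂ : ℝ) (A : Matrix (Slot R) (Slot R) ℂ) (r : Slot R → ℂ) :
    Slot R → ℂ :=
  (Real.sqrt (P₂ / (1 + P₁)) : ℂ) • (A *ᵥ r)

/-- The vector `y = ∑_j g_j t_j + w` received by the destination when the message is `k`. -/
def received {R L : ℕ} (u : Slot R → ℤ) (M : Matrix (Fin R) (Fin R) ℂ) (P₁ P₂ : ℝ) (k : Fin L)
    (ω : Realization R) : Slot R → ℂ :=
  match ω with
  | (f, g, n, w) =>
    ∑ j, g j • relayTransmitted P₁ P₂ (relayMatrix M j)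
      (relayReceived P₁ (sourceVector u k) f n j) + w

/-! ### Maximum likelihood decoding -/

/-- `Σ_y = ρ S diag(|g_1|², …, |g_R|²) Sᴴ + γ I`, where `ρ = P₁ P₂ T / (1 + P₁)`, `T = 2R`, and
`γ = 1 + P₂ / (1 + P₁) ∑_j |g_j|²`: the conditional covariance of `y` given `S` and `g`. -/
def covariance {R : ℕ} (P₁ P₂ : ℝ) (S : Matrix (Slot R) (Fin R) ℂ) (g : Fin R → ℂ) :
    Matrix (Slot R) (Slot R) ℂ :=
  ((P₁ * P₂ * (2 * R) / (1 + P₁) : ℝ) : ℂ) •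
      (S * Matrix.diagonal (fun j => ((‖g j‖ ^ 2 : ℝ) : ℂ)) * Sᴴ) +
    ((1 + P₂ / (1 + P₁) * ∑ j, ‖g j‖ ^ 2 : ℝ) : ℂ) • (1 : Matrix (Slot R) (Slot R) ℂ)

/-- The conditional probability density of the received vector `y` given `S` and `g`
(the determinant and the quadratic form are real). -/
def likelihood {R : ℕ} (P₁ P₂ : ℝ) (S : Matrix (Slot R) (Fin R) ℂ) (g : Fin R → ℂ)
    (y : Slot R → ℂ) : ℝ :=
  (Real.pi ^ (2 * R) * (covariance P₁ P₂ S g).det.re)⁻¹ *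
    Real.exp (-(star y ⬝ᵥ ((covariance P₁ P₂ S g)⁻¹ *ᵥ y)).re)

/-- `dec` is a partially coherent maximum likelihood decoder: from `g` and `y` (but not `f`) it
computes, measurably, a message that maximizes the likelihood. Ties are broken arbitrarily. -/
structure IsMLDecoder {R L : ℕ} (u : Slot R → ℤ) (M : Matrix (Fin R) (Fin R) ℂ) (P₁ P₂ : ℝ)
    (dec : (Fin R → ℂ) → (Slot R → ℂ) → Fin L) : Prop where
  measurable : Measurable fun z : (Fin R → ℂ) × (Slot R → ℂ) => dec z.1 z.2
  isMax : ∀ g y (k : Fin L),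
    likelihood P₁ P₂ (codeword u M k) g y ≤ likelihood P₁ P₂ (codeword u M (dec g y)) g y

/-- The block error probability of the decoder `dec`, for equiprobable messages. -/
def blockErrorProb {R L : ℕ} (u : Slot R → ℤ) (M : Matrix (Fin R) (Fin R) ℂ) (P₁ P₂ : ℝ)
    (dec : (Fin R → ℂ) → (Slot R → ℂ) → Fin L) : ℝ :=
  (1 / L : ℝ) * ∑ k : Fin L,
    (channelLaw R).real {ω | dec ω.2.1 (received u M P₁ P₂ k ω) ≠ k}

/-- An error probability, as a function of the total power `P`, has diversity order `d` if it
decays like `P ^ (-d + o(1))` as `P → ∞`. -/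
def HasDiversityOrder (Pe : ℝ → ℝ) (d : ℝ) : Prop :=
  Filter.Tendsto (fun P => -Real.log (Pe P) / Real.log P) Filter.atTop (nhds d)

end

end RelayNetwork

/-! Up to noise of bounded size, the destination sees `Sₖ (f * g)` amplified by a gain of order
`√P`. All codewords give the covariance of `y` the same determinant, so the decoder compares
quadratic forms, and the quadratic form is the least cost of explaining `y` by a fading vector and
a noise vector. Hence a message that is preferred to the true one comes with a fading vector that
explains `y` almost as well, and if every `[Sₙ Sₘ]` is invertible, this makes `‖f * g‖` at most a
polynomial in the norms of fading and noise, divided by the gain. As `∏ |fⱼ gⱼ| ^ (-2 s)` is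
integrable for `s < 1`, Markov's inequality bounds the error probability by a multiple of
`P ^ (-s R)`.

Conversely, if the signals of two messages differ by `O(1)`, the Gaussian laws of `y` overlap and
the decoder fails on one of the two with probability bounded below. This happens whenever
`‖f * g‖ ≤ P ^ (-1/2)`, an event of probability of order at least `P ^ (-R)`. If `[Sₙ Sₘ]` is
singular, there are `a ≠ 0` and `|z| = 1` with `Sₙ a = z Sₘ a`; since `z f` has the law of `f`,
it then suffices that `f * g` be at distance `P ^ (-1/2)` from the line of `a`, which costs only
`R - 1` complex degrees of freedom and leaves a probability of order at least `P ^ (-(R - 1))`.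

Finally, `det [Sₙ Sₘ]` is up to a nonzero factor the product over `i` of
`ζ ^ ((n - m) (uᵢ - u_{R+i})) - 1`, with `ζ = exp (2πj / L)`. -/

namespace RelayNetwork

noncomputable section

open MeasureTheory Filter Asymptotics

/-! ### Diversity order and power-law bounds -/

section Asymptotics

open Topology

variable {Pe : ℝ → ℝ} {b d : ℝ}

theorem eventually_neg_log_div_log_le_of_isBigO (h : (fun P : ℝ => P ^ (-b)) =O[atTop] Pe)
    (hbd : b < d) : ∀ᶠ P in atTop, -Real.log (Pe P) / Real.log P ≤ d := by
  obtain ⟨C, hC, hle⟩ := h.exists_pos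
  filter_upwards [hle.bound, eventually_gt_atTop 1,
    Real.tendsto_log_atTop.eventually_ge_atTop (Real.log C / (d - b))] with P hP hP1 hlog
  have hP0 : 0 < P := by linarith
  have hpow : 0 < P ^ (-b) := Real.rpow_pos_of_pos hP0 _
  rw [Real.norm_of_nonneg hpow.le] at hP
  have hPe : 0 < ‖Pe P‖ := pos_of_mul_pos_right (hpow.trans_le hP) hC.le
  have hlogle : -b * Real.log P ≤ Real.log C + Real.log (Pe P) := by
    rw [← Real.log_rpow hP0, ← Real.log_abs (Pe P), ← Real.norm_eq_abs,
      ← Real.log_mul hC.ne' hPe.ne']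
    exact Real.log_le_log hpow hP
  rw [div_le_iff₀ (sub_pos.2 hbd)] at hlog
  rw [div_le_iff₀ (Real.log_pos hP1)]
  linarith

theorem eventually_le_neg_log_div_log_of_isBigO (h : Pe =O[atTop] fun P : ℝ => P ^ (-b))
    (hPe : ∀ᶠ P in atTop, Pe P ≠ 0) (hdb : d < b) :
    ∀ᶠ P in atTop, d ≤ -Real.log (Pe P) / Real.log P := by
  obtain ⟨C, hC, hle⟩ := h.exists_pos
  filter_upwards [hle.bound, hPe, eventually_gt_atTop 1,
    Real.tendsto_log_atTop.eventually_ge_atTop (Real.log C / (b - d))] with P hP hPe hP1 hlog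
  have hP0 : 0 < P := by linarith
  have hpow : 0 < P ^ (-b) := Real.rpow_pos_of_pos hP0 _
  rw [Real.norm_of_nonneg hpow.le] at hP
  have hlogle : Real.log (Pe P) ≤ Real.log C + -b * Real.log P := by
    rw [← Real.log_rpow hP0, ← Real.log_abs (Pe P), ← Real.norm_eq_abs,
      ← Real.log_mul hC.ne' hpow.ne']
    exact Real.log_le_log (norm_pos_iff.2 hPe) hP
  rw [div_le_iff₀ (sub_pos.2 hdb)] at hlog
  rw [le_div_iff₀ (Real.log_pos hP1)]
  linarith

theorem HasDiversityOrder.le_of_isBigO (hd : HasDiversityOrder Pe d)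
    (h : (fun P : ℝ => P ^ (-b)) =O[atTop] Pe) : d ≤ b :=
  le_of_forall_gt_imp_ge_of_dense fun _ hc =>
    le_of_tendsto hd (eventually_neg_log_div_log_le_of_isBigO h hc)

theorem hasDiversityOrder_of_isBigO (hlower : (fun P : ℝ => P ^ (-d)) =O[atTop] Pe)
    (hupper : ∀ b < d, Pe =O[atTop] fun P : ℝ => P ^ (-b)) : HasDiversityOrder Pe d := by
  have hPe : ∀ᶠ P in atTop, Pe P ≠ 0 := by
    filter_upwards [hlower.eq_zero_imp, eventually_gt_atTop 0] with P hzero hP hPe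
    exact (Real.rpow_pos_of_pos hP _).ne' (hzero hPe)
  refine tendsto_order.2 ⟨fun a ha => ?_, fun a ha => ?_⟩
  · obtain ⟨c, hac, hcd⟩ := exists_between ha
    obtain ⟨b, hcb, hbd⟩ := exists_between hcd
    filter_upwards [eventually_le_neg_log_div_log_of_isBigO (hupper b hbd) hPe hcb] with P hP
    exact hac.trans_le hP
  · obtain ⟨c, hdc, hca⟩ := exists_between ha
    filter_upwards [eventually_neg_log_div_log_le_of_isBigO hlower hdc] with P hP
    exact hP.trans_lt hca

end Asymptotics

/-! ### Complex Gaussian vectors -/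

section Gaussian

open Metric

instance : NullSingletonClass cscg := by
  unfold cscg
  infer_instance

theorem integrable_norm_rpow_cscg {q : ℝ} (hq : -2 < q) :
    Integrable (fun z : ℂ => ‖z‖ ^ q) cscg := by
  have hint : Integrable fun z : ℂ => ‖z‖ ^ q * Real.exp (-‖z‖ ^ (2 : ℝ)) := by
    refine not_imp_comm.1 integral_undef ?_
    rw [Complex.integral_rpow_mul_exp_neg_rpow one_le_two hq]
    have := Real.Gamma_pos_of_pos (by linarith : 0 < (q + 2) / 2)
    positivity
  rw [cscg, integrable_withDensity_iff (by fun_prop) (ae_of_all _ fun _ => ENNReal.ofReal_lt_top)]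
  refine (hint.const_mul Real.pi⁻¹).congr (ae_of_all _ fun z => ?_)
  simp only [Real.rpow_two]
  rw [ENNReal.toReal_ofReal (by positivity)]
  ring

theorem integrable_one_add_norm_pow_mul_norm_rpow_cscg (p : ℕ) {s : ℝ} (hs : s < 2) :
    Integrable (fun z : ℂ => (1 + ‖z‖) ^ p * ‖z‖ ^ (-s)) cscg := by
  have hsum : Integrable (fun z : ℂ => ∑ k ∈ Finset.range (p + 1),
      (p.choose k : ℝ) * ‖z‖ ^ ((k : ℝ) + -s)) cscg :=
    integrable_finsetSum _ fun k _ => (integrable_norm_rpow_cscg <| by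
      linarith [k.cast_nonneg (α := ℝ)]).const_mul _
  refine hsum.congr ?_
  filter_upwards [compl_mem_ae_iff.2 (measure_singleton (μ := cscg) 0)] with z hz
  rw [add_comm 1, add_pow, Finset.sum_mul]
  refine Finset.sum_congr rfl fun k _ => ?_
  rw [Real.rpow_add (norm_pos_iff.2 hz), Real.rpow_natCast]
  ring

section Product

variable {ι : Type*} [Fintype ι] {E : Type*} [NormedAddCommGroup E]

theorem one_add_norm_le_prod (x : ι → E) : 1 + ‖x‖ ≤ ∏ i, (1 + ‖x i‖) := by
  classical
  have hone : ∀ s : Finset ι, 1 ≤ ∏ i ∈ s, (1 + ‖x i‖) := fun s =>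
    Finset.one_le_prod fun i _ => le_add_of_nonneg_right (norm_nonneg _)
  suffices ‖x‖ ≤ ∏ i, (1 + ‖x i‖) - 1 by linarith
  refine (pi_norm_le_iff_of_nonneg (sub_nonneg.2 (hone _))).2 fun i => ?_
  rw [← Finset.mul_prod_erase _ _ (Finset.mem_univ i)]
  nlinarith [norm_nonneg (x i), hone (Finset.univ.erase i)]

variable [MeasurableSpace E] [BorelSpace E] [SecondCountableTopology E] {μ : Measure E}
  [SigmaFinite μ]

theorem integrable_one_add_norm_pow_mul_prod_pi {p : ℕ} {φ : E → ℝ} (hφ : Measurable φ)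
    (hφ₀ : ∀ x, 0 ≤ φ x) (h : Integrable (fun x => (1 + ‖x‖) ^ p * φ x) μ) :
    Integrable (fun x : ι → E => (1 + ‖x‖) ^ p * ∏ i, φ (x i)) (Measure.pi fun _ => μ) := by
  refine (Integrable.fintype_prod fun _ : ι => h).mono' (by fun_prop) (ae_of_all _ fun x => ?_)
  have hprod : 0 ≤ ∏ i, φ (x i) := Finset.prod_nonneg fun i _ => hφ₀ (x i)
  rw [Real.norm_of_nonneg (by positivity), Finset.prod_mul_distrib, Finset.prod_pow]
  gcongr
  exact one_add_norm_le_prod x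

theorem integrable_one_add_norm_pow_pi {p : ℕ} (h : Integrable (fun x => (1 + ‖x‖) ^ p) μ) :
    Integrable (fun x : ι → E => (1 + ‖x‖) ^ p) (Measure.pi fun _ => μ) := by
  simpa using integrable_one_add_norm_pow_mul_prod_pi (ι := ι) measurable_const
    (fun _ => zero_le_one) (by simpa using h)

end Product

theorem measurePreserving_mul_cscg {z : ℂ} (hz : ‖z‖ = 1) :
    MeasurePreserving (fun x : ℂ => z * x) cscg cscg := by
  have hvol : MeasurePreserving (fun x : ℂ => z * x) :=
    (rotation ⟨z, mem_sphere_zero_iff_norm.2 hz⟩).measurePreserving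
  refine ⟨by fun_prop, Measure.ext fun s hs => ?_⟩
  rw [Measure.map_apply (by fun_prop) hs, cscg, withDensity_apply _ hs,
    withDensity_apply _ (hvol.measurable hs), ← hvol.setLIntegral_comp_preimage hs (by fun_prop)]
  simp only [norm_mul, hz, one_mul]

theorem smul_restrict_closedBall_le_cscg (r : ℝ) :
    ENNReal.ofReal (Real.pi⁻¹ * Real.exp (-r ^ 2)) • volume.restrict (closedBall (0 : ℂ) r) ≤
      cscg := by
  rw [← withDensity_const, ← withDensity_indicator measurableSet_closedBall, cscg]
  refine withDensity_mono (ae_of_all _ fun z => ?_)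
  refine Set.indicator_apply_le' (fun hz => ENNReal.ofReal_le_ofReal ?_) fun _ => zero_le
  rw [mem_closedBall_zero_iff] at hz
  gcongr

section Density

variable {ι : Type*} [Fintype ι]

theorem le_measurePi {X : ι → Type*} [∀ i, MeasurableSpace (X i)] {μ : ∀ i, Measure (X i)}
    {ν : Measure (∀ i, X i)} (h : ∀ s : ∀ i, Set (X i), ν (Set.univ.pi s) ≤ ∏ i, μ i (s i)) :
    ν ≤ Measure.pi μ := by
  refine Measure.le_iff'.2 fun s => ?_
  rw [Measure.pi_def]
  exact (OuterMeasure.le_pi.2 (fun t _ => h t) s).trans (le_toMeasure_apply _ _ s)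

theorem smul_restrict_closedBall_le_pi_cscg {r : ℝ} (hr : 0 ≤ r) :
    ENNReal.ofReal (Real.pi⁻¹ * Real.exp (-r ^ 2)) ^ Fintype.card ι •
      volume.restrict (closedBall (0 : ι → ℂ) r) ≤ Measure.pi fun _ => cscg := by
  refine le_measurePi fun s => ?_
  rw [Measure.smul_apply, closedBall_pi _ hr, volume_pi, Measure.restrict_pi_pi, Measure.pi_pi,
    smul_eq_mul, ← Finset.card_univ, ← Finset.prod_const, ← Finset.prod_mul_distrib]
  exact Finset.prod_le_prod' fun i _ => smul_restrict_closedBall_le_cscg r (s i)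

theorem mul_volume_le_pi_cscg {r : ℝ} (hr : 0 ≤ r) {s : Set (ι → ℂ)} (hs : s ⊆ closedBall 0 r) :
    ENNReal.ofReal (Real.pi⁻¹ * Real.exp (-r ^ 2)) ^ Fintype.card ι * volume s ≤
      Measure.pi (fun _ => cscg) s := by
  simpa [Measure.restrict_eq_self _ hs] using smul_restrict_closedBall_le_pi_cscg hr s

theorem mul_volume_pi_closedBall {a : ℝ} (ha : 0 ≤ a) {r : ι → ℝ} (hr : ∀ i, 0 ≤ r i) :
    ENNReal.ofReal (Real.pi⁻¹ * a) ^ Fintype.card ι *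
      volume (Set.univ.pi fun i => closedBall (0 : ℂ) (r i)) =
        ENNReal.ofReal (a ^ Fintype.card ι * ∏ i, r i ^ 2) := by
  have hfactor : ∀ i, ENNReal.ofReal (Real.pi⁻¹ * a) * volume (closedBall (0 : ℂ) (r i)) =
      ENNReal.ofReal (a * r i ^ 2) := fun i => by
    rw [Complex.volume_closedBall, ← ENNReal.ofReal_pow (hr i), ← ENNReal.ofReal_coe_nnreal,
      NNReal.coe_real_pi, ← ENNReal.ofReal_mul (by positivity),
      ← ENNReal.ofReal_mul (by positivity)]
    congr 1
    field_simp
  rw [volume_pi_pi, ← Finset.card_univ, ← Finset.prod_const, ← Finset.prod_mul_distrib,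
    Finset.prod_congr rfl fun i _ => hfactor i,
    ← ENNReal.ofReal_prod_of_nonneg fun i _ => by positivity, Finset.prod_mul_distrib,
    Finset.prod_const]

/-- Shift the unit ball of noise vectors by the distance of the two means: both shifted balls lie in
a ball on which the density is bounded below. -/
theorem le_pi_cscg_add_pi_cscg {C : ℝ} {T T' : ι → ℂ} (hT : ‖T - T'‖ ≤ C) {A A' : Set (ι → ℂ)}
    (hA : A ∪ A' = Set.univ) :
    ENNReal.ofReal (Real.exp (-(C + 1) ^ 2) ^ Fintype.card ι) ≤
      Measure.pi (fun _ => cscg) {w | T + w ∈ A} +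
        Measure.pi (fun _ => cscg) {w | T' + w ∈ A'} := by
  have hC : 0 ≤ C := (norm_nonneg _).trans hT
  set c := ENNReal.ofReal (Real.pi⁻¹ * Real.exp (-(C + 1) ^ 2)) ^ Fintype.card ι
  have hball : c * volume (closedBall (0 : ι → ℂ) 1) =
      ENNReal.ofReal (Real.exp (-(C + 1) ^ 2) ^ Fintype.card ι) := by
    simpa [closedBall_pi] using mul_volume_pi_closedBall (Real.exp_nonneg (-(C + 1) ^ 2))
      (r := fun _ : ι => (1 : ℝ)) fun _ => zero_le_one
  have hleft : c * volume (closedBall 0 1 ∩ {w | T + w ∈ A}) ≤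
      Measure.pi (fun _ => cscg) {w | T + w ∈ A} :=
    (mul_volume_le_pi_cscg (by linarith) (Set.inter_subset_left.trans
      (closedBall_subset_closedBall (by linarith)))).trans (measure_mono Set.inter_subset_right)
  have hright : c * volume (closedBall 0 1 ∩ {w | T + w ∈ A'}) ≤
      Measure.pi (fun _ => cscg) {w | T' + w ∈ A'} := by
    rw [← measure_preimage_add_right volume (T' - T)]
    refine (mul_volume_le_pi_cscg (by linarith) fun w hw => ?_).trans (measure_mono fun w hw => ?_)
    · rw [mem_closedBall_zero_iff]
      calc ‖w‖ = ‖(T - T') + (w + (T' - T))‖ := by congr 1; abel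
        _ ≤ C + 1 := norm_add_le_of_le hT (mem_closedBall_zero_iff.1 hw.1)
    · have hmem : T + (w + (T' - T)) ∈ A' := hw.2
      rwa [show T + (w + (T' - T)) = T' + w by abel] at hmem
  calc _ = c * volume (closedBall 0 1 ∩ ({w | T + w ∈ A} ∪ {w | T + w ∈ A'})) := by
        have hcover : {w | T + w ∈ A} ∪ {w | T + w ∈ A'} = Set.univ :=
          congrArg ((T + ·) ⁻¹' ·) hA
        rw [hcover, Set.inter_univ, hball]
    _ ≤ c * volume (closedBall 0 1 ∩ {w | T + w ∈ A}) +
        c * volume (closedBall 0 1 ∩ {w | T + w ∈ A'}) := by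
        rw [Set.inter_union_distrib_left, ← mul_add]
        gcongr
        exact measure_union_le _ _
    _ ≤ _ := add_le_add hleft hright

end Density

section Tube

variable {ι : Type*} {p : ι} {κ : ι → ℂ} {ρ δ : ℝ}

/-- The tube of radius `δ` around the part `‖z‖ ≤ ρ` of the complex line `{z • κ}`, parametrized by
the coordinate `p`, at which `κ` is meant to be `1`. -/
def tube (p : ι) (κ : ι → ℂ) (ρ δ : ℝ) : Set (ι → ℂ) :=
  {h | ‖h p‖ ≤ ρ ∧ ∀ j, ‖h j - κ j * h p‖ ≤ δ}

theorem isClosed_tube : IsClosed (tube p κ ρ δ) := by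
  simp only [tube, Set.ofPred_and, Set.ofPred_forall]
  exact (isClosed_le (by fun_prop) continuous_const).inter
    (isClosed_iInter fun j => isClosed_le (by fun_prop) continuous_const)

variable [Fintype ι]

theorem volume_tube [DecidableEq ι] (hκ : κ p = 1) (hδ : 0 ≤ δ) :
    volume (tube p κ ρ δ) =
      volume (Set.univ.pi fun i => closedBall (0 : ℂ) (Function.update (fun _ => δ) p ρ i)) := by
  set e := (LinearMap.transvection (-LinearMap.proj p : Module.Dual ℂ (ι → ℂ))
    (κ - Pi.single p 1)).restrictScalars ℝ with he
  have hdet : LinearMap.det e = 1 := by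
    simp [he, LinearMap.det_restrictScalars, LinearMap.transvection.det, hκ]
  have hpreimage : tube p κ ρ δ =
      e ⁻¹' Set.univ.pi fun i => closedBall (0 : ℂ) (Function.update (fun _ => δ) p ρ i) := by
    ext h
    have hp : e h p = h p := by simp [he, LinearMap.transvection.apply, hκ]
    have hne : ∀ j ≠ p, e h j = h j - κ j * h p := fun j hj => by
      simp [he, LinearMap.transvection.apply, hj, mul_comm, sub_eq_add_neg]
    simp only [tube, Set.mem_ofPred_eq, Set.mem_preimage, Set.mem_univ_pi, mem_closedBall_zero_iff]
    refine ⟨fun hh j => ?_, fun hh => ⟨by simpa [hp] using hh p, fun j => ?_⟩⟩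
    · obtain rfl | hj := eq_or_ne j p
      · simpa [hp] using hh.1
      · simpa [hne j hj, hj] using hh.2 j
    · obtain rfl | hj := eq_or_ne j p
      · simpa [hκ] using hδ
      · simpa [hne j hj, hj] using hh j
  rw [hpreimage, Measure.addHaar_preimage_linearMap _ (by rw [hdet]; exact one_ne_zero), hdet]
  simp only [inv_one, abs_one, ENNReal.ofReal_one, one_mul]

theorem tube_subset_closedBall (hκ : ∀ j, ‖κ j‖ ≤ 2) (hρ : ρ ≤ 1) (hδ : δ ≤ 1) :
    tube p κ ρ δ ⊆ closedBall 0 3 := fun h hh => by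
  refine mem_closedBall_zero_iff.2 ((pi_norm_le_iff_of_nonneg (by norm_num)).2 fun j => ?_)
  calc ‖h j‖ = ‖κ j * h p + (h j - κ j * h p)‖ := by rw [add_sub_cancel]
    _ ≤ ‖κ j‖ * ‖h p‖ + ‖h j - κ j * h p‖ := by grw [norm_add_le, norm_mul]
    _ ≤ 2 * 1 + 1 := by
      gcongr
      exacts [hκ j, hh.1.trans hρ, (hh.2 j).trans hδ]
    _ = 3 := by norm_num

theorem le_pi_cscg_tube (hκp : κ p = 1) (hκ : ∀ j, ‖κ j‖ ≤ 2) (hρ₀ : 0 ≤ ρ) (hρ₁ : ρ ≤ 1)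
    (hδ₀ : 0 ≤ δ) (hδ₁ : δ ≤ 1) :
    ENNReal.ofReal (Real.exp (-3 ^ 2) ^ Fintype.card ι *
      (ρ ^ 2 * (δ ^ 2) ^ (Fintype.card ι - 1))) ≤ Measure.pi (fun _ => cscg) (tube p κ ρ δ) := by
  classical
  refine le_trans (le_of_eq ?_) (mul_volume_le_pi_cscg (by norm_num : (0 : ℝ) ≤ 3)
    (tube_subset_closedBall hκ hρ₁ hδ₁))
  have hr : ∀ i, 0 ≤ Function.update (fun _ => δ) p ρ i :=
    fun i => Function.update_apply (fun _ => δ) p ρ i ▸ by split_ifs <;> assumption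
  rw [volume_tube hκp hδ₀, mul_volume_pi_closedBall (Real.exp_nonneg _) hr,
    ← Finset.mul_prod_erase _ _ (Finset.mem_univ p), Function.update_self,
    Finset.prod_congr rfl fun i hi => by rw [Function.update_of_ne (Finset.ne_of_mem_erase hi)],
    Finset.prod_const, Finset.card_erase_of_mem (Finset.mem_univ p), Finset.card_univ]

end Tube

end Gaussian

/-! ### The determinant of a pair of codewords -/

section Code

open Matrix

theorem det_fromBlocks_diagonal {n A : Type*} [Fintype n] [DecidableEq n] [CommRing A]
    (a b c d : n → A) :
    (fromBlocks (diagonal a) (diagonal b) (diagonal c) (diagonal d)).det =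
      ∏ i, (a i * d i - b i * c i) := by
  let e : Fin 2 × n ≃ n ⊕ n :=
    (finTwoEquiv.prodCongr (Equiv.refl n)).trans (Equiv.boolProdEquivSum n)
  have hreindex : (fromBlocks (diagonal a) (diagonal b) (diagonal c) (diagonal d)).submatrix e e =
      blockDiagonal fun i => !![a i, b i; c i, d i] := by
    ext ⟨k, i⟩ ⟨l, j⟩
    fin_cases k <;> fin_cases l <;>
      simp [e, finTwoEquiv, blockDiagonal_apply, diagonal_apply]
  rw [← det_submatrix_equiv_self e, hreindex, det_blockDiagonal]
  simp only [det_fin_two_of]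

theorem gcd_eq_one_iff_forall_not_dvd {L : ℕ} (hL : L ≠ 0) {d : ℤ} :
    Int.gcd d L = 1 ↔ ∀ n m : Fin L, n ≠ m → ¬(L : ℤ) ∣ d * ((n : ℤ) - m) := by
  refine ⟨fun hgcd n m hnm hdvd => hnm (Fin.ext ?_), fun h => ?_⟩
  · have hsub : (n : ℤ) - m = 0 :=
      Int.eq_zero_of_abs_lt_dvd (((Int.isCoprime_iff_gcd_eq_one.2 hgcd).symm).dvd_of_dvd_mul_left
        hdvd) (abs_lt.2 ⟨by omega, by omega⟩)
    omega
  · by_contra hgcd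
    obtain ⟨e, he⟩ : d.gcd L ∣ L := by exact_mod_cast Int.gcd_dvd_right d (L : ℤ)
    obtain ⟨f, hf⟩ := Int.gcd_dvd_left d (L : ℤ)
    set g := d.gcd L
    have he₀ : 0 < e := Nat.pos_of_ne_zero (by rintro rfl; simp_all)
    have hg₀ : g ≠ 0 := by rintro hg; simp_all
    have heL : e < L := by nlinarith [show 2 ≤ g by omega]
    refine h ⟨e, heL⟩ ⟨0, he₀.trans heL⟩ (by simpa using he₀.ne') ⟨f, ?_⟩
    have hgL : (L : ℤ) = g * e := by exact_mod_cast he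
    rw [hgL, hf]
    push_cast
    ring

/-- The root of unity `exp (2π√-1 / L)`, of which the diagonal entries of the generator are
powers. -/
def zeta (L : ℕ) : ℂ := Complex.exp (2 * Real.pi * Complex.I / L)

/-- The `i`-th diagonal entry of the power `D^(k+1)` of the generator that encodes `k : Fin L`. -/
def phase {R L : ℕ} (u : Slot R → ℤ) (k : Fin L) (i : Slot R) : ℂ := zeta L ^ (((k : ℤ) + 1) * u i)

/-- The scale `(2R)^{-1/2}` of the codewords. -/
def amplitude (R : ℕ) : ℂ := ((1 / Real.sqrt (2 * R) : ℝ) : ℂ)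

variable {R L : ℕ} {u : Slot R → ℤ} {M : Matrix (Fin R) (Fin R) ℂ}

theorem zeta_ne_zero : zeta L ≠ 0 := Complex.exp_ne_zero _

theorem norm_zeta : ‖zeta L‖ = 1 := by
  rw [zeta, show 2 * Real.pi * Complex.I / (L : ℂ) = (2 * Real.pi / L : ℝ) * Complex.I by
    push_cast; ring, Complex.norm_exp_ofReal_mul_I]

theorem norm_phase (k : Fin L) (i : Slot R) : ‖phase u k i‖ = 1 := by
  rw [phase, norm_zpow, norm_zeta, _root_.one_zpow]

theorem phase_ne_zero (k : Fin L) (i : Slot R) : phase u k i ≠ 0 :=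
  zpow_ne_zero _ zeta_ne_zero

theorem phase_mul_phase_eq_iff (n m : Fin L) (i j : Slot R) :
    phase u n i * phase u m j = phase u m i * phase u n j ↔
      (L : ℤ) ∣ (u i - u j) * ((n : ℤ) - m) := by
  have hζ : IsPrimitiveRoot (zeta L) L := Complex.isPrimitiveRoot_exp L (Fin.pos n).ne'
  rw [← hζ.zpow_eq_one_iff_dvd, ← div_eq_one_iff_eq (mul_ne_zero (phase_ne_zero m i)
    (phase_ne_zero n j))]
  simp only [phase, ← zpow_add₀ zeta_ne_zero, ← zpow_sub₀ zeta_ne_zero]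
  ring_nf

theorem generator_pow_eq_diagonal (k : Fin L) :
    generator L u ^ ((k : ℕ) + 1) = diagonal (phase u k) := by
  rw [generator, diagonal_pow]
  congr 1
  ext i
  rw [Pi.pow_apply, phase, zeta, ← Complex.exp_nat_mul, ← Complex.exp_int_mul]
  push_cast
  ring_nf

theorem codeword_apply (k : Fin L) (i : Slot R) (j : Fin R) :
    codeword u M k i j = stacked M i j * sourceVector u k i := by
  rw [codeword, of_apply, relayMatrix, mulVec_diagonal]

theorem codeword_eq_mul (k : Fin L) :
    codeword u M k = diagonal (phase u k) * (amplitude R • stacked M) := by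
  ext i j
  simp only [codeword_apply, sourceVector, generator_pow_eq_diagonal, mulVec_diagonal,
    initialVector, amplitude, diagonal_mul, Matrix.smul_apply, smul_eq_mul]
  ring

theorem amplitude_ne_zero (hR : 1 ≤ R) : amplitude R ≠ 0 := by
  have : (0 : ℝ) < 2 * R := by positivity
  exact Complex.ofReal_ne_zero.2 (by positivity)

theorem fromCols_codeword (n m : Fin L) :
    fromCols (codeword u M n) (codeword u M m) =
      fromBlocks (diagonal fun i => phase u n (.inl i)) (diagonal fun i => phase u m (.inl i))
          (diagonal fun i => phase u n (.inr i)) (diagonal fun i => phase u m (.inr i)) *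
        fromBlocks (amplitude R • M) 0 0 (amplitude R • M) := by
  ext (i | i) (j | j) <;>
    simp [fromBlocks_multiply, codeword_eq_mul, stacked, diagonal_mul]

theorem det_fromCols_codeword (n m : Fin L) :
    (fromCols (codeword u M n) (codeword u M m)).det =
      (∏ i, (phase u n (.inl i) * phase u m (.inr i) - phase u m (.inl i) * phase u n (.inr i))) *
        (amplitude R • M).det ^ 2 := by
  rw [fromCols_codeword, det_mul, det_fromBlocks_diagonal, det_fromBlocks_zero₂₁, sq]

theorem det_fromCols_codeword_ne_zero_iff (hR : 1 ≤ R) (hM : M.det ≠ 0) (n m : Fin L) :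
    (fromCols (codeword u M n) (codeword u M m)).det ≠ 0 ↔
      ∀ i, ¬(L : ℤ) ∣ (u (.inl i) - u (.inr i)) * ((n : ℤ) - m) := by
  have hdet : (amplitude R • M).det ≠ 0 := by
    rw [det_smul]
    exact mul_ne_zero (pow_ne_zero _ (amplitude_ne_zero hR)) hM
  simp only [det_fromCols_codeword, mul_ne_zero_iff, Finset.prod_ne_zero_iff, Finset.mem_univ,
    true_imp_iff, sub_ne_zero, ne_eq, phase_mul_phase_eq_iff, pow_ne_zero 2 hdet, not_false_eq_true,
    and_true]

theorem meetsDeterminantCriterion_codeword_iff (hR : 1 ≤ R) (hL : L ≠ 0) (hM : M.det ≠ 0) :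
    MeetsDeterminantCriterion (fun k : Fin L => codeword u M k) ↔
      ∀ i, Int.gcd (u (.inl i) - u (.inr i)) (L : ℤ) = 1 := by
  have hpair : ∀ n m : Fin L, ((fromCols (codeword u M n) (codeword u M m))ᴴ *
      fromCols (codeword u M n) (codeword u M m)).det ≠ 0 ↔
      ∀ i, ¬(L : ℤ) ∣ (u (.inl i) - u (.inr i)) * ((n : ℤ) - m) := fun n m => by
    rw [← det_fromCols_codeword_ne_zero_iff hR hM, det_mul, det_conjTranspose, mul_ne_zero_iff,
      star_ne_zero, and_self]
  simp only [MeetsDeterminantCriterion, hpair, gcd_eq_one_iff_forall_not_dvd hL]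
  exact ⟨fun h i n m hnm => h n m hnm i, fun h n m hnm i => h i n m hnm⟩

theorem exists_codeword_mulVec_eq (hM : M.det ≠ 0) {n m : Fin L} {i : Fin R}
    (hdvd : (L : ℤ) ∣ (u (.inl i) - u (.inr i)) * ((n : ℤ) - m)) :
    ∃ a : Fin R → ℂ, a ≠ 0 ∧ ∃ z : ℂ, ‖z‖ = 1 ∧
      codeword u M n *ᵥ a = z • codeword u M m *ᵥ a := by
  have hMa : M *ᵥ (M⁻¹ *ᵥ Pi.single i 1) = Pi.single i 1 := by
    rw [mulVec_mulVec, mul_nonsing_inv _ hM.isUnit, one_mulVec]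
  refine ⟨M⁻¹ *ᵥ Pi.single i 1, fun h => ?_, phase u n (.inl i) / phase u m (.inl i),
    by rw [norm_div, norm_phase, norm_phase, div_one], ?_⟩
  · simpa [h] using congrFun hMa i
  have hratio : phase u n (.inr i) =
      phase u n (.inl i) / phase u m (.inl i) * phase u m (.inr i) := by
    rw [div_mul_eq_mul_div, eq_div_iff (phase_ne_zero _ _), mul_comm]
    exact ((phase_mul_phase_eq_iff n m _ _).2 hdvd).symm
  have hcode : ∀ (k : Fin L) (s : Slot R), (codeword u M k *ᵥ (M⁻¹ *ᵥ Pi.single i 1)) s =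
      phase u k s * (amplitude R * Sum.elim (Pi.single i 1) (Pi.single i 1) s) := fun k s => by
    simp only [codeword_eq_mul, ← mulVec_mulVec, smul_mulVec, stacked, fromRows_mulVec, hMa,
      mulVec_diagonal, Pi.smul_apply, smul_eq_mul]
  ext (j | j) <;> rw [Pi.smul_apply, hcode, hcode, smul_eq_mul]
  all_goals obtain rfl | hji := eq_or_ne j i
  · rw [← mul_assoc (_ / _), div_mul_cancel₀ _ (phase_ne_zero _ _)]
  · simp [hji]
  · rw [hratio, mul_assoc]
  · simp [hji]

end Code

/-! ### The likelihood of a Gaussian signal in Gaussian noise -/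

section Likelihood

open Matrix
open scoped ComplexOrder

variable {m n : Type*} [Fintype n]

theorem sum_norm_sq_eq_star_dotProduct (v : n → ℂ) :
    ((∑ j, ‖v j‖ ^ 2 : ℝ) : ℂ) = star v ⬝ᵥ v := by
  simp only [dotProduct, Complex.ofReal_sum, Complex.ofReal_pow, ← Complex.conj_mul', Pi.star_apply,
    Complex.star_def]

/-- The covariance `A Aᴴ + γ I` of `A f + v`, where `f` is a standard complex Gaussian vector and
`v` an independent complex Gaussian vector of variance `γ`. -/
def signalCovariance [DecidableEq m] (A : Matrix m n ℂ) (γ : ℝ) : Matrix m m ℂ :=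
  A * Aᴴ + (γ : ℂ) • 1

/-- The penalized least squares cost of explaining the observation `y` by the signal `A f`. -/
def explanationCost [Fintype m] (A : Matrix m n ℂ) (γ : ℝ) (y : m → ℂ) (f : n → ℂ) : ℝ :=
  ∑ j, ‖f j‖ ^ 2 + γ⁻¹ * ∑ i, ‖(y - A *ᵥ f) i‖ ^ 2

variable [DecidableEq m] {A : Matrix m n ℂ} {γ : ℝ}

theorem signalCovariance_posDef [Finite m] (hγ : 0 < γ) : (signalCovariance A γ).PosDef :=
  PosDef.posSemidef_add (posSemidef_self_mul_conjTranspose A)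
    (PosDef.one.smul (Complex.zero_lt_real.2 hγ))

variable [Fintype m]

theorem signalCovariance_mulVec (q : m → ℂ) :
    signalCovariance A γ *ᵥ q = A *ᵥ (Aᴴ *ᵥ q) + (γ : ℂ) • q := by
  rw [signalCovariance, add_mulVec, smul_mulVec, one_mulVec, mulVec_mulVec]

theorem explanationCost_add (hγ : γ ≠ 0) (q : m → ℂ) (h : n → ℂ) :
    (explanationCost A γ (signalCovariance A γ *ᵥ q) (Aᴴ *ᵥ q + h) : ℂ) =
      star (signalCovariance A γ *ᵥ q) ⬝ᵥ q + explanationCost A γ 0 h := by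
  have hresidual : signalCovariance A γ *ᵥ q - A *ᵥ (Aᴴ *ᵥ q + h) = (γ : ℂ) • q - A *ᵥ h := by
    rw [signalCovariance_mulVec, mulVec_add]
    abel
  have hright : ∀ x, star q ⬝ᵥ (A *ᵥ x) = star (Aᴴ *ᵥ q) ⬝ᵥ x := fun x => by
    rw [dotProduct_mulVec, star_mulVec, conjTranspose_conjTranspose]
  have hleft : ∀ x, star (A *ᵥ x) ⬝ᵥ q = star x ⬝ᵥ (Aᴴ *ᵥ q) := fun x => by
    rw [star_mulVec, dotProduct_mulVec]
  have hγ' : (γ : ℂ) ≠ 0 := Complex.ofReal_ne_zero.2 hγ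
  simp only [explanationCost, hresidual]
  simp only [zero_sub, Complex.ofReal_add, Complex.ofReal_mul,
    Complex.ofReal_inv, sum_norm_sq_eq_star_dotProduct, star_add, star_sub, star_neg, star_smul,
    add_dotProduct, sub_dotProduct, dotProduct_add, dotProduct_sub, neg_dotProduct_neg,
    smul_dotProduct, dotProduct_smul, smul_eq_mul, Complex.star_def, Complex.conj_ofReal,
    signalCovariance_mulVec, hright, hleft]
  field_simp
  ring

theorem isLeast_explanationCost (hγ : 0 < γ) (y : m → ℂ) :
    IsLeast (Set.range (explanationCost A γ y))
      (star y ⬝ᵥ ((signalCovariance A γ)⁻¹ *ᵥ y)).re := by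
  set q := (signalCovariance A γ)⁻¹ *ᵥ y with hq
  have hy : signalCovariance A γ *ᵥ q = y := by
    rw [hq, mulVec_mulVec, mul_nonsing_inv _ (signalCovariance_posDef hγ).det_pos.ne'.isUnit,
      one_mulVec]
  have hcost : ∀ h, explanationCost A γ y (Aᴴ *ᵥ q + h) =
      (star y ⬝ᵥ q).re + explanationCost A γ 0 h := fun h => by
    simpa only [hy, Complex.ofReal_re, Complex.add_re] using
      congrArg Complex.re (explanationCost_add (A := A) hγ.ne' q h)
  refine ⟨⟨Aᴴ *ᵥ q, by simpa [explanationCost] using hcost 0⟩, ?_⟩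
  rintro _ ⟨f, rfl⟩
  rw [← add_sub_cancel (Aᴴ *ᵥ q) f, hcost]
  exact le_add_of_nonneg_right (by unfold explanationCost; positivity)

end Likelihood

section Decision

open Matrix
open scoped Matrix.Norms.Operator

variable {m n n' : Type*} [Fintype m] [Fintype n] [Fintype n']

theorem sum_norm_sq_le_card_mul (v : n → ℂ) : ∑ j, ‖v j‖ ^ 2 ≤ Fintype.card n * ‖v‖ ^ 2 := by
  refine (Finset.sum_le_sum fun j _ => pow_le_pow_left₀ (norm_nonneg _) (norm_le_pi_norm v j)
    2).trans_eq ?_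
  rw [Finset.sum_const, Finset.card_univ, nsmul_eq_mul]

theorem norm_sq_le_sum_norm_sq (v : n → ℂ) : ‖v‖ ^ 2 ≤ ∑ j, ‖v j‖ ^ 2 := by
  have hsum : 0 ≤ ∑ j, ‖v j‖ ^ 2 := by positivity
  rw [← Real.le_sqrt (norm_nonneg _) hsum, pi_norm_le_iff_of_nonneg (Real.sqrt_nonneg _)]
  exact fun j => Real.le_sqrt_of_sq_le
    (Finset.single_le_sum (f := fun j => ‖v j‖ ^ 2) (fun _ _ => by positivity) (Finset.mem_univ j))

theorem norm_residual_sq_le_of_explanationCost_le {A B : Matrix m n ℂ} {γ : ℝ} (hγ : 0 < γ)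
    {y : m → ℂ} {f f' : n → ℂ} (h : explanationCost B γ y f' ≤ explanationCost A γ y f) :
    ‖y - B *ᵥ f'‖ ^ 2 ≤
      γ * (Fintype.card n * ‖f‖ ^ 2) + Fintype.card m * ‖y - A *ᵥ f‖ ^ 2 := by
  have hscale := mul_le_mul_of_nonneg_left h hγ.le
  simp only [explanationCost, mul_add, mul_inv_cancel_left₀ hγ.ne'] at hscale
  calc ‖y - B *ᵥ f'‖ ^ 2 ≤ ∑ i, ‖(y - B *ᵥ f') i‖ ^ 2 := norm_sq_le_sum_norm_sq _
    _ ≤ γ * ∑ j, ‖f' j‖ ^ 2 + ∑ i, ‖(y - B *ᵥ f') i‖ ^ 2 :=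
        le_add_of_nonneg_left (by positivity)
    _ ≤ _ := hscale.trans (add_le_add
        (mul_le_mul_of_nonneg_left (sum_norm_sq_le_card_mul f) hγ.le) (sum_norm_sq_le_card_mul _))

theorem norm_le_of_mul_fromCols_eq_one [DecidableEq n] [DecidableEq n'] {S : Matrix m n ℂ}
    {T : Matrix m n' ℂ} {N : Matrix (n ⊕ n') m ℂ} (hN : N * fromCols S T = 1) (a : n → ℂ)
    (b : n' → ℂ) (y : m → ℂ) : ‖a‖ ≤ ‖N‖ * (‖y - S *ᵥ a‖ + ‖y - T *ᵥ b‖) := by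
  have hsub : fromCols S T *ᵥ Sum.elim a (-b) = (y - T *ᵥ b) - (y - S *ᵥ a) := by
    rw [fromCols_mulVec, Sum.elim_comp_inl, Sum.elim_comp_inr, mulVec_neg]
    abel
  have hab : Sum.elim a (-b) = N *ᵥ ((y - T *ᵥ b) - (y - S *ᵥ a)) := by
    rw [← hsub, mulVec_mulVec, hN, one_mulVec]
  calc ‖a‖ ≤ ‖Sum.elim a (-b)‖ :=
        (pi_norm_le_iff_of_nonneg (norm_nonneg _)).2 fun j =>
          norm_le_pi_norm (Sum.elim a (-b)) (Sum.inl j)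
    _ ≤ ‖N‖ * ‖(y - T *ᵥ b) - (y - S *ᵥ a)‖ := hab ▸ linfty_opNorm_mulVec N _
    _ ≤ _ := mul_le_mul_of_nonneg_left ((norm_sub_le _ _).trans_eq (add_comm _ _)) (norm_nonneg _)

end Decision

/-! ### The channel and the maximum likelihood decision -/

section Channel

open Matrix
open scoped Matrix.Norms.Operator ComplexOrder

variable {R L : ℕ} {u : Slot R → ℤ} {M : Matrix (Fin R) (Fin R) ℂ} {P₁ P₂ : ℝ}

/-- The amplitude gain `√ρ` of the channel from the source to the destination, with `ρ` as in
`covariance`. -/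
def gain (R : ℕ) (P₁ P₂ : ℝ) : ℝ := Real.sqrt (P₁ * P₂ * (2 * R) / (1 + P₁))

/-- The conditional variance `γ` of the noise at the destination, with `γ` as in `covariance`. -/
def noiseLevel (P₁ P₂ : ℝ) (g : Fin R → ℂ) : ℝ := 1 + P₂ / (1 + P₁) * ∑ j, ‖g j‖ ^ 2

/-- The matrix of the linear map from the fading vector `f` to the signal at the destination, when
the codeword is `S` and the fading vector of the relays is `g`. -/
def channelMatrix (P₁ P₂ : ℝ) (S : Matrix (Slot R) (Fin R) ℂ) (g : Fin R → ℂ) :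
    Matrix (Slot R) (Fin R) ℂ :=
  (gain R P₁ P₂ : ℂ) • (S * diagonal g)

/-- The noise of the relays as it arrives at the destination. -/
def relayNoise (M : Matrix (Fin R) (Fin R) ℂ) (P₁ P₂ : ℝ) (g : Fin R → ℂ)
    (n : Fin R → Slot R → ℂ) : Slot R → ℂ :=
  fun i => Real.sqrt (P₂ / (1 + P₁)) * (stacked M *ᵥ fun j => g j * n j i) i

/-- The event that the decoder `dec` fails on the message `k`. -/
def errorEvent (u : Slot R → ℤ) (M : Matrix (Fin R) (Fin R) ℂ) (P₁ P₂ : ℝ)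
    (dec : (Fin R → ℂ) → (Slot R → ℂ) → Fin L) (k : Fin L) : Set (Realization R) :=
  {ω | dec ω.2.1 (received u M P₁ P₂ k ω) ≠ k}

theorem gain_nonneg : 0 ≤ gain R P₁ P₂ := Real.sqrt_nonneg _

theorem one_le_noiseLevel (h₁ : 0 ≤ P₁) (h₂ : 0 ≤ P₂) (g : Fin R → ℂ) :
    1 ≤ noiseLevel P₁ P₂ g :=
  le_add_of_nonneg_right (by positivity)

theorem channelMatrix_mulVec (S : Matrix (Slot R) (Fin R) ℂ) (f g : Fin R → ℂ) :
    channelMatrix P₁ P₂ S g *ᵥ f = S *ᵥ ((gain R P₁ P₂ : ℂ) • (f * g)) := by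
  rw [channelMatrix, smul_mulVec, ← mulVec_mulVec, mulVec_smul, mul_comm f g]
  congr 2
  ext j
  rw [mulVec_diagonal, Pi.mul_apply]

theorem received_eq (h₁ : 0 ≤ P₁) (k : Fin L) (f g : Fin R → ℂ) (n : Fin R → Slot R → ℂ)
    (w : Slot R → ℂ) :
    received u M P₁ P₂ k (f, g, n, w) =
      channelMatrix P₁ P₂ (codeword u M k) g *ᵥ f + (relayNoise M P₁ P₂ g n + w) := by
  have hgain : gain R P₁ P₂ = Real.sqrt (P₁ * (2 * R)) * Real.sqrt (P₂ / (1 + P₁)) := by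
    rw [gain, ← Real.sqrt_mul (by positivity)]
    ring_nf
  ext i
  simp only [received, relayTransmitted, relayReceived, relayMatrix, channelMatrix_mulVec,
    relayNoise, mulVec_diagonal, Pi.add_apply, Finset.sum_apply, Pi.smul_apply, smul_eq_mul]
  simp only [mulVec, dotProduct, codeword_apply, hgain, Pi.smul_apply, Pi.mul_apply, smul_eq_mul,
    Complex.ofReal_mul, ← add_assoc, Finset.mul_sum, ← Finset.sum_add_distrib]
  congr 1
  refine Finset.sum_congr rfl fun j _ => ?_
  ring

theorem covariance_eq_signalCovariance (h₁ : 0 ≤ P₁) (h₂ : 0 ≤ P₂)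
    (S : Matrix (Slot R) (Fin R) ℂ) (g : Fin R → ℂ) :
    covariance P₁ P₂ S g =
      signalCovariance (channelMatrix P₁ P₂ S g) (noiseLevel P₁ P₂ g) := by
  have hgg : diagonal g * (diagonal g)ᴴ = diagonal fun j => ((‖g j‖ ^ 2 : ℝ) : ℂ) := by
    rw [diagonal_conjTranspose, diagonal_mul_diagonal]
    congr 1
    ext j
    rw [Pi.star_apply, Complex.star_def, Complex.mul_conj', Complex.ofReal_pow]
  have hgain : (gain R P₁ P₂ : ℂ) * gain R P₁ P₂ = (P₁ * P₂ * (2 * R) / (1 + P₁) : ℝ) := by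
    rw [← Complex.ofReal_mul, gain, Real.mul_self_sqrt (by positivity)]
  rw [covariance, signalCovariance, channelMatrix, noiseLevel, conjTranspose_smul,
    Matrix.smul_mul, Matrix.mul_smul, smul_smul, Complex.star_def, Complex.conj_ofReal, hgain,
    conjTranspose_mul, ← hgg]
  simp only [Matrix.mul_assoc]

theorem covariance_mul_of_mul_conjTranspose_eq_one {E : Matrix (Slot R) (Slot R) ℂ}
    (hE : E * Eᴴ = 1) (S : Matrix (Slot R) (Fin R) ℂ) (g : Fin R → ℂ) :
    covariance P₁ P₂ (E * S) g = E * covariance P₁ P₂ S g * Eᴴ := by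
  simp only [covariance, conjTranspose_mul, Matrix.mul_add, Matrix.add_mul, Matrix.mul_smul,
    Matrix.smul_mul, Matrix.mul_one, hE, Matrix.mul_assoc]

theorem diagonal_phase_mul_conjTranspose (k : Fin L) :
    diagonal (phase u k) * (diagonal (phase u k))ᴴ = 1 := by
  rw [diagonal_conjTranspose, diagonal_mul_diagonal, ← diagonal_one]
  congr 1
  ext i
  rw [Pi.star_apply, Complex.star_def, Complex.mul_conj', norm_phase, Complex.ofReal_one, one_pow]

theorem det_covariance_codeword (g : Fin R → ℂ) (k : Fin L) :
    (covariance P₁ P₂ (codeword u M k) g).det =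
      (covariance P₁ P₂ (amplitude R • stacked M) g).det := by
  rw [codeword_eq_mul, covariance_mul_of_mul_conjTranspose_eq_one
    (diagonal_phase_mul_conjTranspose k), det_mul_right_comm, diagonal_phase_mul_conjTranspose,
    Matrix.one_mul]

theorem exists_explanationCost_le_of_likelihood_le (h₁ : 0 ≤ P₁) (h₂ : 0 ≤ P₂) {k m : Fin L}
    {g : Fin R → ℂ} {y : Slot R → ℂ}
    (h : likelihood P₁ P₂ (codeword u M k) g y ≤ likelihood P₁ P₂ (codeword u M m) g y)
    (f : Fin R → ℂ) :
    ∃ f', explanationCost (channelMatrix P₁ P₂ (codeword u M m) g) (noiseLevel P₁ P₂ g) y f' ≤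
      explanationCost (channelMatrix P₁ P₂ (codeword u M k) g) (noiseLevel P₁ P₂ g) y f := by
  have hγ : 0 < noiseLevel P₁ P₂ g := one_pos.trans_le (one_le_noiseLevel h₁ h₂ g)
  have hdet : 0 < (covariance P₁ P₂ (amplitude R • stacked M) g).det.re := by
    rw [covariance_eq_signalCovariance h₁ h₂]
    exact (Complex.pos_iff.1 (signalCovariance_posDef (n := Fin R) hγ).det_pos).1
  simp only [likelihood, det_covariance_codeword] at h
  have hquad := neg_le_neg_iff.1 (Real.exp_le_exp.1 (le_of_mul_le_mul_left h (by positivity)))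
  rw [covariance_eq_signalCovariance h₁ h₂, covariance_eq_signalCovariance h₁ h₂] at hquad
  obtain ⟨f', hf'⟩ :=
    (isLeast_explanationCost (A := channelMatrix P₁ P₂ (codeword u M m) g) hγ y).1
  exact ⟨f', hf'.trans_le (hquad.trans ((isLeast_explanationCost hγ y).2 ⟨f, rfl⟩))⟩

/-- The polynomial size of a realization, in terms of which the error event is estimated. -/
def realizationSize (ω : Realization R) : ℝ :=
  (1 + ‖ω.1‖) * ((1 + ‖ω.2.1‖) * ((1 + ‖ω.2.2.1‖) * (1 + ‖ω.2.2.2‖)))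

theorem one_le_realizationSize (ω : Realization R) : 1 ≤ realizationSize ω :=
  sub_nonneg.1 (by rw [realizationSize]; ring_nf; positivity)

theorem norm_fst_le_realizationSize (ω : Realization R) : ‖ω.1‖ ≤ realizationSize ω :=
  sub_nonneg.1 (by rw [realizationSize]; ring_nf; positivity)

theorem norm_snd_fst_le_realizationSize (ω : Realization R) : ‖ω.2.1‖ ≤ realizationSize ω :=
  sub_nonneg.1 (by rw [realizationSize]; ring_nf; positivity)

theorem norm_mul_norm_le_realizationSize (ω : Realization R) :
    ‖ω.2.1‖ * ‖ω.2.2.1‖ ≤ realizationSize ω :=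
  sub_nonneg.1 (by rw [realizationSize]; ring_nf; positivity)

theorem norm_snd_snd_snd_le_realizationSize (ω : Realization R) :
    ‖ω.2.2.2‖ ≤ realizationSize ω :=
  sub_nonneg.1 (by rw [realizationSize]; ring_nf; positivity)

theorem norm_relayNoise_le (g : Fin R → ℂ) (n : Fin R → Slot R → ℂ) :
    ‖relayNoise M P₁ P₂ g n‖ ≤ Real.sqrt (P₂ / (1 + P₁)) * (‖stacked M‖ * (‖g‖ * ‖n‖)) := by
  refine (pi_norm_le_iff_of_nonneg (by positivity)).2 fun i => ?_
  rw [relayNoise, norm_mul, Complex.norm_real, Real.norm_of_nonneg (Real.sqrt_nonneg _)]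
  refine mul_le_mul_of_nonneg_left ?_ (Real.sqrt_nonneg _)
  refine (norm_le_pi_norm _ i).trans ((linfty_opNorm_mulVec _ _).trans
    (mul_le_mul_of_nonneg_left ?_ (norm_nonneg _)))
  refine (pi_norm_le_iff_of_nonneg (by positivity)).2 fun j => ?_
  rw [norm_mul]
  exact mul_le_mul (norm_le_pi_norm g j) ((norm_le_pi_norm (n j) i).trans (norm_le_pi_norm n j))
    (norm_nonneg _) (norm_nonneg _)

theorem norm_received_sub_le {β : ℝ} (h₁ : 0 ≤ P₁) (hβ : P₂ / (1 + P₁) ≤ β) (k : Fin L)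
    (ω : Realization R) :
    ‖received u M P₁ P₂ k ω - channelMatrix P₁ P₂ (codeword u M k) ω.2.1 *ᵥ ω.1‖ ≤
      (Real.sqrt β * ‖stacked M‖ + 1) * realizationSize ω :=
  calc _ = ‖relayNoise M P₁ P₂ ω.2.1 ω.2.2.1 + ω.2.2.2‖ := by
        rw [received_eq h₁, add_sub_cancel_left]
    _ ≤ Real.sqrt (P₂ / (1 + P₁)) * (‖stacked M‖ * (‖ω.2.1‖ * ‖ω.2.2.1‖)) + ‖ω.2.2.2‖ :=
        (norm_add_le _ _).trans (add_le_add_left (norm_relayNoise_le _ _) _)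
    _ ≤ Real.sqrt β * (‖stacked M‖ * realizationSize ω) + realizationSize ω := by
        gcongr
        exacts [norm_mul_norm_le_realizationSize ω, norm_snd_snd_snd_le_realizationSize ω]
    _ = _ := by ring

theorem noiseLevel_le {β : ℝ} (hβ₀ : 0 ≤ β) (hβ : P₂ / (1 + P₁) ≤ β) (ω : Realization R) :
    noiseLevel P₁ P₂ ω.2.1 ≤ (1 + β * R) * realizationSize ω ^ 2 :=
  calc noiseLevel P₁ P₂ ω.2.1 ≤ 1 + β * (R * ‖ω.2.1‖ ^ 2) := by
        rw [noiseLevel]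
        gcongr
        simpa only [Fintype.card_fin] using sum_norm_sq_le_card_mul ω.2.1
    _ ≤ realizationSize ω ^ 2 + β * (R * realizationSize ω ^ 2) := by
        gcongr
        exacts [one_le_pow₀ (one_le_realizationSize ω), norm_snd_fst_le_realizationSize ω]
    _ = _ := by ring

theorem norm_received_sub_le_of_explanationCost_le {β : ℝ} (hβ₀ : 0 ≤ β) (h₁ : 0 ≤ P₁)
    (h₂ : 0 ≤ P₂) (hβ : P₂ / (1 + P₁) ≤ β) {k m : Fin L} {ω : Realization R} {f' : Fin R → ℂ}
    (h : explanationCost (channelMatrix P₁ P₂ (codeword u M m) ω.2.1) (noiseLevel P₁ P₂ ω.2.1)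
        (received u M P₁ P₂ k ω) f' ≤
      explanationCost (channelMatrix P₁ P₂ (codeword u M k) ω.2.1) (noiseLevel P₁ P₂ ω.2.1)
        (received u M P₁ P₂ k ω) ω.1) :
    ‖received u M P₁ P₂ k ω - channelMatrix P₁ P₂ (codeword u M m) ω.2.1 *ᵥ f'‖ ≤
      Real.sqrt ((1 + β * R) * R +
        Fintype.card (Slot R) * (Real.sqrt β * ‖stacked M‖ + 1) ^ 2) * realizationSize ω ^ 2 := by
  have hX : 1 ≤ realizationSize ω := one_le_realizationSize ω
  refine (sq_le_sq₀ (norm_nonneg _) (by positivity)).1 ?_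
  calc _ ≤ noiseLevel P₁ P₂ ω.2.1 * (R * ‖ω.1‖ ^ 2) + Fintype.card (Slot R) *
        ‖received u M P₁ P₂ k ω - channelMatrix P₁ P₂ (codeword u M k) ω.2.1 *ᵥ ω.1‖ ^ 2 := by
        simpa only [Fintype.card_fin] using norm_residual_sq_le_of_explanationCost_le
          (one_pos.trans_le (one_le_noiseLevel h₁ h₂ ω.2.1)) h
    _ ≤ (1 + β * R) * realizationSize ω ^ 2 * (R * realizationSize ω ^ 2) +
        Fintype.card (Slot R) *
          ((Real.sqrt β * ‖stacked M‖ + 1) * realizationSize ω ^ 2) ^ 2 := by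
        gcongr
        exacts [noiseLevel_le hβ₀ hβ ω, norm_fst_le_realizationSize ω,
          (norm_received_sub_le h₁ hβ k ω).trans (by gcongr; exact le_self_pow₀ hX two_ne_zero)]
    _ = _ := by
        rw [mul_pow (Real.sqrt _), Real.sq_sqrt (by positivity)]
        ring

theorem exists_gain_mul_norm_le
    (hdet : ∀ k m : Fin L, k ≠ m → (fromCols (codeword u M k) (codeword u M m)).det ≠ 0)
    {β : ℝ} (hβ₀ : 0 ≤ β) :
    ∃ C : ℝ, 0 ≤ C ∧ ∀ P₁ P₂ : ℝ, 0 ≤ P₁ → 0 ≤ P₂ → P₂ / (1 + P₁) ≤ β → ∀ dec,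
      IsMLDecoder u M P₁ P₂ dec → ∀ k : Fin L, ∀ ω ∈ errorEvent u M P₁ P₂ dec k, ∀ j,
        gain R P₁ P₂ * (‖ω.1 j‖ * ‖ω.2.1 j‖) ≤ C * realizationSize ω ^ 2 := by
  obtain ⟨B, hB⟩ := Finite.bddAbove_range fun p : Fin L × Fin L =>
    ‖(fromCols (codeword u M p.1) (codeword u M p.2))⁻¹‖
  set c := Real.sqrt β * ‖stacked M‖ + 1
  set c' := Real.sqrt ((1 + β * R) * R + Fintype.card (Slot R) * c ^ 2)
  refine ⟨max B 0 * (c + c'), by positivity, ?_⟩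
  intro P₁ P₂ h₁ h₂ hβ dec hdec k ω herr j
  set X := realizationSize ω
  set y := received u M P₁ P₂ k ω
  have hX : 1 ≤ X := one_le_realizationSize _
  obtain ⟨f', hf'⟩ := exists_explanationCost_le_of_likelihood_le h₁ h₂ (hdec.isMax ω.2.1 y k) ω.1
  have htrue : ‖y - channelMatrix P₁ P₂ (codeword u M k) ω.2.1 *ᵥ ω.1‖ ≤ c * X :=
    norm_received_sub_le h₁ hβ k ω
  have hfalse : ‖y - channelMatrix P₁ P₂ (codeword u M (dec ω.2.1 y)) ω.2.1 *ᵥ f'‖ ≤ c' * X ^ 2 :=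
    norm_received_sub_le_of_explanationCost_le hβ₀ h₁ h₂ hβ hf'
  rw [channelMatrix_mulVec] at htrue hfalse
  calc gain R P₁ P₂ * (‖ω.1 j‖ * ‖ω.2.1 j‖) = ‖((gain R P₁ P₂ : ℂ) • (ω.1 * ω.2.1)) j‖ := by
        rw [Pi.smul_apply, Pi.mul_apply, smul_eq_mul, norm_mul, norm_mul, Complex.norm_real,
          Real.norm_of_nonneg gain_nonneg]
    _ ≤ ‖(gain R P₁ P₂ : ℂ) • (ω.1 * ω.2.1)‖ := norm_le_pi_norm _ j
    _ ≤ max B 0 * (c * X + c' * X ^ 2) := by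
        refine (norm_le_of_mul_fromCols_eq_one (nonsing_inv_mul _ (hdet k _ herr.symm).isUnit) _ _
          y).trans (mul_le_mul ((hB ⟨(k, dec ω.2.1 y), rfl⟩).trans (le_max_left _ _))
            (add_le_add htrue hfalse) (by positivity) (le_max_right _ _))
    _ ≤ max B 0 * (c * X ^ 2 + c' * X ^ 2) := by
        gcongr
        exact le_self_pow₀ hX two_ne_zero
    _ = _ := by ring

end Channel

/-! ### The upper bound on the error probability -/

section UpperBound

variable {R L : ℕ} {u : Slot R → ℤ} {M : Matrix (Fin R) (Fin R) ℂ} {s : ℝ}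

instance : IsProbabilityMeasure (channelLaw R) := by
  rw [channelLaw]
  infer_instance

theorem ae_fading_ne_zero : ∀ᵐ ω ∂channelLaw R, ∀ j, ω.1 j ≠ 0 ∧ ω.2.1 j ≠ 0 := by
  have hne : ∀ᵐ f : Fin R → ℂ ∂Measure.pi fun _ => cscg, ∀ j, f j ≠ 0 :=
    ae_all_iff.2 fun j => Measure.ae_eval_ne _ j 0
  filter_upwards [Measure.quasiMeasurePreserving_fst.ae hne,
    Measure.quasiMeasurePreserving_snd.ae (Measure.quasiMeasurePreserving_fst.ae hne)]
    with ω hf hg j using ⟨hf j, hg j⟩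

/-- The function of the realization that dominates, up to a constant, the `(s R)`-th power of the
gain on the error event. -/
def majorant (s : ℝ) (ω : Realization R) : ℝ :=
  realizationSize ω ^ (4 * R) * ∏ j, (‖ω.1 j‖ ^ (-s) * ‖ω.2.1 j‖ ^ (-s))

theorem majorant_nonneg (ω : Realization R) : 0 ≤ majorant s ω := by
  have := zero_le_one.trans (one_le_realizationSize ω)
  unfold majorant
  positivity

theorem integrable_majorant (hs : s < 2) : Integrable (majorant s) (channelLaw R) := by
  have hfading : Integrable (fun f : Fin R → ℂ => (1 + ‖f‖) ^ (4 * R) * ∏ j, ‖f j‖ ^ (-s))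
      (Measure.pi fun _ => cscg) :=
    integrable_one_add_norm_pow_mul_prod_pi (φ := fun z : ℂ => ‖z‖ ^ (-s)) (by fun_prop)
      (fun _ => by positivity) (integrable_one_add_norm_pow_mul_norm_rpow_cscg _ hs)
  have hscalar : Integrable (fun z : ℂ => (1 + ‖z‖) ^ (4 * R)) cscg := by
    simpa using integrable_one_add_norm_pow_mul_norm_rpow_cscg (4 * R) two_pos
  have hnoise := integrable_one_add_norm_pow_pi (ι := Slot R) hscalar
  refine (hfading.mul_prod (hfading.mul_prod
    ((integrable_one_add_norm_pow_pi hnoise).mul_prod hnoise))).congr (ae_of_all _ fun ω => ?_)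
  simp only [majorant, realizationSize, Finset.prod_mul_distrib, mul_pow]
  ring

theorem rpow_pow_le_mul_majorant (hs₀ : 0 ≤ s) (hs : s ≤ 2) {G C : ℝ} (hG : 0 ≤ G) (hC : 0 ≤ C)
    {ω : Realization R} (hω : ∀ j, ω.1 j ≠ 0 ∧ ω.2.1 j ≠ 0)
    (h : ∀ j, G * (‖ω.1 j‖ * ‖ω.2.1 j‖) ≤ C * realizationSize ω ^ 2) :
    (G ^ s) ^ R ≤ (C ^ s) ^ R * majorant s ω := by
  have hX : 1 ≤ realizationSize ω := one_le_realizationSize ω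
  have hfactor : ∀ j, G ^ s ≤
      C ^ s * realizationSize ω ^ 4 * (‖ω.1 j‖ ^ (-s) * ‖ω.2.1 j‖ ^ (-s)) := fun j => by
    have hf : 0 < ‖ω.1 j‖ := norm_pos_iff.2 (hω j).1
    have hg : 0 < ‖ω.2.1 j‖ := norm_pos_iff.2 (hω j).2
    rw [← Real.mul_rpow hf.le hg.le, Real.rpow_neg (by positivity), ← div_eq_mul_inv,
      le_div_iff₀ (by positivity), ← Real.mul_rpow hG (by positivity)]
    calc _ ≤ (C * realizationSize ω ^ 2) ^ s := Real.rpow_le_rpow (by positivity) (h j) hs₀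
      _ = C ^ s * (realizationSize ω ^ 2) ^ s := Real.mul_rpow hC (by positivity)
      _ ≤ C ^ s * (realizationSize ω ^ 2) ^ (2 : ℝ) := by
        gcongr
        exact one_le_pow₀ hX
      _ = C ^ s * realizationSize ω ^ 4 := by rw [Real.rpow_two, ← pow_mul]
  calc (G ^ s) ^ R = ∏ _j : Fin R, G ^ s := by
        rw [Finset.prod_const, Finset.card_univ, Fintype.card_fin]
    _ ≤ ∏ j, (C ^ s * realizationSize ω ^ 4 * (‖ω.1 j‖ ^ (-s) * ‖ω.2.1 j‖ ^ (-s))) :=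
        Finset.prod_le_prod (fun _ _ => by positivity) fun j _ => hfactor j
    _ = _ := by
        rw [majorant, Finset.prod_mul_distrib, Finset.prod_const, Finset.card_univ,
          Fintype.card_fin, mul_pow, ← pow_mul, mul_assoc]

theorem blockErrorProb_nonneg {P₁ P₂ : ℝ} {dec : (Fin R → ℂ) → (Slot R → ℂ) → Fin L} :
    0 ≤ blockErrorProb u M P₁ P₂ dec :=
  mul_nonneg (by positivity) (Finset.sum_nonneg fun _ _ => measureReal_nonneg)

theorem mul_blockErrorProb_le {P₁ P₂ : ℝ} {dec : (Fin R → ℂ) → (Slot R → ℂ) → Fin L} {c K : ℝ}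
    (hK : 0 ≤ K)
    (h : ∀ k : Fin L, c * (channelLaw R).real (errorEvent u M P₁ P₂ dec k) ≤ K) :
    c * blockErrorProb u M P₁ P₂ dec ≤ K := by
  rw [blockErrorProb, mul_left_comm, Finset.mul_sum]
  calc _ ≤ (1 / L : ℝ) * (L * K) := by
        refine mul_le_mul_of_nonneg_left ((Finset.sum_le_card_nsmul _ _ K fun k _ => h k).trans_eq
          ?_) (by positivity)
        rw [Finset.card_univ, Fintype.card_fin, nsmul_eq_mul]
    _ = (L * (L : ℝ)⁻¹) * K := by ring
    _ ≤ K := mul_le_of_le_one_left hK mul_inv_le_one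

theorem exists_gain_rpow_mul_blockErrorProb_le
    (hdet : ∀ k m : Fin L, k ≠ m →
      (Matrix.fromCols (codeword u M k) (codeword u M m)).det ≠ 0)
    {β : ℝ} (hβ₀ : 0 ≤ β) (hs₀ : 0 ≤ s) (hs : s < 2) :
    ∃ K : ℝ, ∀ P₁ P₂ : ℝ, 0 ≤ P₁ → 0 ≤ P₂ → P₂ / (1 + P₁) ≤ β →
      ∀ dec : (Fin R → ℂ) → (Slot R → ℂ) → Fin L, IsMLDecoder u M P₁ P₂ dec →
        (gain R P₁ P₂ ^ s) ^ R * blockErrorProb u M P₁ P₂ dec ≤ K := by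
  obtain ⟨C, hC₀, hC⟩ := exists_gain_mul_norm_le hdet hβ₀
  have hnonneg : ∀ ω : Realization R, 0 ≤ (C ^ s) ^ R * majorant s ω := fun ω =>
    mul_nonneg (by positivity) (majorant_nonneg ω)
  refine ⟨∫ ω, (C ^ s) ^ R * majorant s ω ∂channelLaw R, fun P₁ P₂ h₁ h₂ hβ dec hdec =>
    mul_blockErrorProb_le (integral_nonneg hnonneg) fun k => ?_⟩
  have hG : 0 ≤ gain R P₁ P₂ := gain_nonneg
  refine le_trans (mul_le_mul_of_nonneg_left ?_ (by positivity)) (mul_meas_ge_le_integral_of_nonneg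
    (ae_of_all _ hnonneg) ((integrable_majorant hs).const_mul _) ((gain R P₁ P₂ ^ s) ^ R))
  refine ENNReal.toReal_mono (measure_ne_top _ _) (measure_mono_ae ?_)
  filter_upwards [ae_fading_ne_zero] with ω hω herr using
    rpow_pow_le_mul_majorant hs₀ hs.le hG hC₀ hω (hC P₁ P₂ h₁ h₂ hβ dec hdec k ω herr)

theorem gain_sq {α P : ℝ} (hR : R ≠ 0) (hα₀ : 0 ≤ α) (hα₁ : α ≤ 1) (hP : 0 ≤ P) :
    gain R (α * P) ((1 - α) * P / R) ^ 2 = 2 * (1 - α) * P * (α * P / (1 + α * P)) := by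
  have := sub_nonneg.2 hα₁
  rw [gain, Real.sq_sqrt (by positivity)]
  field_simp

theorem mul_le_gain_sq {α P : ℝ} (hR : R ≠ 0) (hα₀ : 0 ≤ α) (hα₁ : α ≤ 1) (hP : 1 ≤ P) :
    α * (1 - α) * P ≤ gain R (α * P) ((1 - α) * P / R) ^ 2 := by
  have := sub_nonneg.2 hα₁
  have hP₀ : 0 ≤ P := zero_le_one.trans hP
  have hhalf : α / 2 ≤ α * P / (1 + α * P) := by
    rw [div_le_div_iff₀ two_pos (by positivity)]
    nlinarith [mul_le_mul_of_nonneg_left hα₁ (mul_nonneg hα₀ hP₀)]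
  rw [gain_sq hR hα₀ hα₁ hP₀]
  calc α * (1 - α) * P = 2 * (1 - α) * P * (α / 2) := by ring
    _ ≤ _ := by gcongr

theorem blockErrorProb_isBigO_rpow_neg {α : ℝ} (hR : R ≠ 0) (hα₀ : 0 < α) (hα₁ : α < 1)
    (hdet : ∀ k m : Fin L, k ≠ m →
      (Matrix.fromCols (codeword u M k) (codeword u M m)).det ≠ 0)
    {dec : ℝ → (Fin R → ℂ) → (Slot R → ℂ) → Fin L}
    (hdec : ∀ᶠ P in atTop, IsMLDecoder u M (α * P) ((1 - α) * P / R) (dec P))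
    (hs₀ : 0 ≤ s) (hs : s < 1) :
    (fun P => blockErrorProb u M (α * P) ((1 - α) * P / R) (dec P)) =O[atTop]
      fun P => P ^ (-(s * R)) := by
  have hα₁' := sub_pos.2 hα₁
  obtain ⟨K, hK⟩ := exists_gain_rpow_mul_blockErrorProb_le (s := 2 * s) hdet
    (β := (1 - α) / (R * α)) (by positivity) (by positivity) (by linarith)
  refine IsBigO.of_bound (((α * (1 - α)) ^ (s * R))⁻¹ * K) ?_
  filter_upwards [hdec, eventually_ge_atTop 1] with P hdecP hP
  have hP₀ : 0 < P := one_pos.trans_le hP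
  have hβ : (1 - α) * P / R / (1 + α * P) ≤ (1 - α) / (R * α) :=
    calc _ ≤ (1 - α) * P / R / (α * P) := by
          gcongr
          exact le_add_of_nonneg_left zero_le_one
      _ = _ := by field_simp
  have hgain : (α * (1 - α)) ^ (s * R) * P ^ (s * R) ≤
      (gain R (α * P) ((1 - α) * P / R) ^ (2 * s)) ^ R := by
    rw [← Real.mul_rpow (by positivity) hP₀.le, ← Real.rpow_mul_natCast gain_nonneg,
      mul_assoc 2, Real.rpow_mul gain_nonneg, Real.rpow_two]
    exact Real.rpow_le_rpow (by positivity) (mul_le_gain_sq hR hα₀.le hα₁.le hP) (by positivity)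
  have hbound := (mul_le_mul_of_nonneg_right hgain blockErrorProb_nonneg).trans
    (hK _ _ (by positivity) (by positivity) hβ (dec P) hdecP)
  rw [Real.norm_of_nonneg blockErrorProb_nonneg, Real.norm_of_nonneg (by positivity),
    Real.rpow_neg hP₀.le, ← div_eq_mul_inv, le_div_iff₀ (by positivity), ← div_eq_inv_mul,
    le_div_iff₀ (by positivity)]
  exact (le_of_eq (by ring)).trans hbound

end UpperBound

/-! ### The lower bound on the error probability -/

theorem mul_le_prod_add_prod {X Y : Type*} [MeasurableSpace X] [MeasurableSpace Y] {μ : Measure X}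
    {ν : Measure Y} [SFinite ν] {a c : ENNReal} {K : Set X} {A A' : Set (X × Y)}
    (hK : MeasurableSet K) (hA : MeasurableSet A) (hA' : MeasurableSet A') (ha : a ≤ μ K)
    (hc : ∀ x ∈ K, c ≤ ν (Prod.mk x ⁻¹' A) + ν (Prod.mk x ⁻¹' A')) :
    a * c ≤ μ.prod ν A + μ.prod ν A' := by
  rw [Measure.prod_apply hA, Measure.prod_apply hA',
    ← lintegral_add_left (measurable_measure_prodMk_left hA)]
  calc a * c ≤ ∫⁻ x, K.indicator (fun _ => c) x ∂μ := by
        rw [lintegral_indicator_const hK, mul_comm]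
        gcongr
    _ ≤ _ := lintegral_mono fun x => Set.indicator_apply_le' (hc x) fun _ => zero_le

section LowerBound

open Matrix Metric
open scoped Matrix.Norms.Operator

variable {R L : ℕ} {u : Slot R → ℤ} {M : Matrix (Fin R) (Fin R) ℂ} {P₁ P₂ : ℝ}
  {dec : (Fin R → ℂ) → (Slot R → ℂ) → Fin L} {n m : Fin L} {z : ℂ} {p : Fin R} {b : Fin R → ℂ}
  {ρ δ C : ℝ}

theorem measurable_received (k : Fin L) : Measurable (received u M P₁ P₂ k) := by
  refine Continuous.measurable ?_
  unfold received relayTransmitted relayReceived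
  fun_prop

theorem measurableSet_errorEvent
    (hdec : Measurable fun x : (Fin R → ℂ) × (Slot R → ℂ) => dec x.1 x.2) (k : Fin L) :
    MeasurableSet (errorEvent u M P₁ P₂ dec k) :=
  (hdec.comp (measurable_snd.fst.prodMk (measurable_received k)))
    (MeasurableSet.of_discrete (s := {k}ᶜ))

theorem measurePreserving_smul_channelLaw (hz : ‖z‖ = 1) :
    MeasurePreserving (fun ω : Realization R => (z • ω.1, ω.2)) (channelLaw R) (channelLaw R) :=
  (measurePreserving_pi (fun _ : Fin R => cscg) (fun _ => cscg)
    fun _ => measurePreserving_mul_cscg hz).prod (MeasurePreserving.id _)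

theorem le_noise_errorEvent_add (h₁ : 0 ≤ P₁)
    (hdec : Measurable fun x : (Fin R → ℂ) × (Slot R → ℂ) => dec x.1 x.2) (hnm : n ≠ m)
    {f g : Fin R → ℂ}
    (h : ‖(codeword u M n - z • codeword u M m) *ᵥ ((gain R P₁ P₂ : ℂ) • (f * g))‖ ≤ C) :
    ENNReal.ofReal (Real.exp (-(C + 1) ^ 2) ^ Fintype.card (Slot R)) ≤
      ((Measure.pi fun _ : Fin R => Measure.pi fun _ : Slot R => cscg).prod
        (Measure.pi fun _ : Slot R => cscg))
          (Prod.mk g ⁻¹' (Prod.mk f ⁻¹' errorEvent u M P₁ P₂ dec n)) +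
      ((Measure.pi fun _ : Fin R => Measure.pi fun _ : Slot R => cscg).prod
        (Measure.pi fun _ : Slot R => cscg))
          (Prod.mk g ⁻¹' (Prod.mk (z • f) ⁻¹' errorEvent u M P₁ P₂ dec m)) := by
  have hmeas : ∀ (k : Fin L) (f : Fin R → ℂ),
      MeasurableSet (Prod.mk g ⁻¹' (Prod.mk f ⁻¹' errorEvent u M P₁ P₂ dec k)) := fun k _ =>
    measurable_prodMk_left (measurable_prodMk_left (measurableSet_errorEvent hdec k))
  rw [← one_mul (ENNReal.ofReal _)]
  refine mul_le_prod_add_prod MeasurableSet.univ (hmeas n f) (hmeas m (z • f)) measure_univ.ge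
    fun ν _ => ?_
  have hcover : {y | dec g y ≠ n} ∪ {y | dec g y ≠ m} = Set.univ :=
    Set.eq_univ_of_forall fun y => not_and_or.1 fun hy => hnm (hy.1.symm.trans hy.2)
  have hmean : ‖(channelMatrix P₁ P₂ (codeword u M n) g *ᵥ f + relayNoise M P₁ P₂ g ν) -
      (channelMatrix P₁ P₂ (codeword u M m) g *ᵥ (z • f) + relayNoise M P₁ P₂ g ν)‖ ≤ C := by
    rwa [add_sub_add_right_eq_sub, channelMatrix_mulVec, channelMatrix_mulVec, smul_mul_assoc,
      smul_comm _ z, mulVec_smul _ z, ← smul_mulVec, ← sub_mulVec]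
  refine (le_pi_cscg_add_pi_cscg hmean hcover).trans_eq ?_
  simp only [errorEvent, Set.preimage_ofPred_eq, received_eq h₁, add_assoc, Set.mem_ofPred_eq]

theorem norm_mem_Icc_of_mem_closedBall {f : Fin R → ℂ}
    (hf : f ∈ closedBall (fun _ : Fin R => (3 / 2 : ℂ)) (1 / 2)) (j : Fin R) :
    ‖f j‖ ∈ Set.Icc 1 2 := by
  have hj : |‖f j‖ - ‖(3 / 2 : ℂ)‖| ≤ 1 / 2 := (abs_norm_sub_norm_le _ _).trans
    ((norm_le_pi_norm (f - fun _ => 3 / 2) j).trans (mem_closedBall_iff_norm.1 hf))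
  norm_num [abs_le] at hj
  constructor <;> linarith

/-- For fixed `f`, the vector `f * g` lies near the line of `b` as soon as `g` lies near the line of
`b / f`. -/
theorem le_pi_cscg_mul_mem_tube {f : Fin R → ℂ}
    (hf : f ∈ closedBall (fun _ : Fin R => (3 / 2 : ℂ)) (1 / 2)) (hbp : b p = 1)
    (hb : ∀ j, ‖b j‖ ≤ 1) (hρ₀ : 0 ≤ ρ) (hρ₁ : ρ ≤ 1) (hδ₀ : 0 ≤ δ) (hδ₁ : δ ≤ 1) :
    ENNReal.ofReal (Real.exp (-3 ^ 2) ^ R * ((ρ / 2) ^ 2 * ((δ / 2) ^ 2) ^ (R - 1))) ≤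
      Measure.pi (fun _ => cscg) {g | f * g ∈ tube p b ρ δ} := by
  have hnorm := norm_mem_Icc_of_mem_closedBall hf
  have hne : ∀ j, f j ≠ 0 := fun j => norm_pos_iff.1 (one_pos.trans_le (hnorm j).1)
  have hκ : ∀ j, ‖b j * (f p / f j)‖ ≤ 2 := fun j => by
    rw [norm_mul, norm_div]
    calc ‖b j‖ * (‖f p‖ / ‖f j‖) ≤ 1 * (2 / 1) := by
          gcongr
          exacts [hb j, (hnorm p).2, (hnorm j).1]
      _ = 2 := by norm_num
  have htube := le_pi_cscg_tube (p := p) (κ := fun j => b j * (f p / f j)) (ρ := ρ / 2)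
    (δ := δ / 2) (by rw [hbp, div_self (hne p), one_mul]) hκ (by linarith) (by linarith)
    (by linarith) (by linarith)
  rw [Fintype.card_fin] at htube
  refine htube.trans (measure_mono fun g hg => ⟨?_, fun j => ?_⟩)
  · calc ‖(f * g) p‖ = ‖f p‖ * ‖g p‖ := by rw [Pi.mul_apply, norm_mul]
      _ ≤ 2 * (ρ / 2) := mul_le_mul (hnorm p).2 hg.1 (norm_nonneg _) zero_le_two
      _ = ρ := by ring
  · calc ‖(f * g) j - b j * (f * g) p‖ = ‖f j‖ * ‖g j - b j * (f p / f j) * g p‖ := by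
          rw [← norm_mul, Pi.mul_apply, Pi.mul_apply]
          have := hne j
          congr 1
          field_simp
      _ ≤ 2 * (δ / 2) := mul_le_mul (hnorm j).2 (hg.2 j) (norm_nonneg _) zero_le_two
      _ = δ := by ring

theorem le_channelLaw_errorEvent_add (h₁ : 0 ≤ P₁)
    (hdec : Measurable fun x : (Fin R → ℂ) × (Slot R → ℂ) => dec x.1 x.2) (hnm : n ≠ m)
    (hz : ‖z‖ = 1) (hbp : b p = 1) (hb : ∀ j, ‖b j‖ ≤ 1) (hρ₀ : 0 ≤ ρ) (hρ₁ : ρ ≤ 1)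
    (hδ₀ : 0 ≤ δ) (hδ₁ : δ ≤ 1)
    (h : ∀ x ∈ tube p b ρ δ,
      ‖(codeword u M n - z • codeword u M m) *ᵥ ((gain R P₁ P₂ : ℂ) • x)‖ ≤ C) :
    Measure.pi (fun _ : Fin R => cscg) (closedBall (fun _ => 3 / 2) (1 / 2)) *
      (ENNReal.ofReal (Real.exp (-3 ^ 2) ^ R * ((ρ / 2) ^ 2 * ((δ / 2) ^ 2) ^ (R - 1))) *
        ENNReal.ofReal (Real.exp (-(C + 1) ^ 2) ^ Fintype.card (Slot R))) ≤
      channelLaw R (errorEvent u M P₁ P₂ dec n) + channelLaw R (errorEvent u M P₁ P₂ dec m) := by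
  have hrotate := measurePreserving_smul_channelLaw (R := R) hz
  have hn := measurableSet_errorEvent (u := u) (M := M) (P₁ := P₁) (P₂ := P₂) hdec n
  have hm := measurableSet_errorEvent (u := u) (M := M) (P₁ := P₁) (P₂ := P₂) hdec m
  rw [← hrotate.measure_preimage hm.nullMeasurableSet]
  refine mul_le_prod_add_prod measurableSet_closedBall hn (hrotate.measurable hm) le_rfl
    fun f hf => ?_
  refine mul_le_prod_add_prod ?_ (measurable_prodMk_left hn)
    (measurable_prodMk_left (hrotate.measurable hm))
    (le_pi_cscg_mul_mem_tube hf hbp hb hρ₀ hρ₁ hδ₀ hδ₁) fun g hg =>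
      le_noise_errorEvent_add h₁ hdec hnm (h _ hg)
  exact (isClosed_tube.preimage (by fun_prop)).measurableSet

end LowerBound

section PairwiseLowerBound

open Matrix Metric
open scoped Matrix.Norms.Operator

variable {R L : ℕ} {u : Slot R → ℤ} {M : Matrix (Fin R) (Fin R) ℂ} {n m : Fin L} {z : ℂ}
  {p : Fin R} {b : Fin R → ℂ} {α : ℝ}

theorem pi_cscg_closedBall_ne_zero :
    Measure.pi (fun _ : Fin R => cscg) (closedBall (fun _ => 3 / 2) (1 / 2)) ≠ 0 := by
  have hsub : closedBall (fun _ : Fin R => (3 / 2 : ℂ)) (1 / 2) ⊆ closedBall 0 2 := fun f hf =>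
    mem_closedBall_zero_iff.2 <| (pi_norm_le_iff_of_nonneg zero_le_two).2 fun j =>
      (norm_mem_Icc_of_mem_closedBall hf j).2
  refine (lt_of_lt_of_le ?_ (mul_volume_le_pi_cscg zero_le_two hsub)).ne'
  refine ENNReal.mul_pos (pow_ne_zero _ ?_) (measure_closedBall_pos _ _ one_half_pos).ne'
  exact (ENNReal.ofReal_pos.2 (by positivity)).ne'

theorem inv_mul_add_le_blockErrorProb {P₁ P₂ : ℝ} {dec : (Fin R → ℂ) → (Slot R → ℂ) → Fin L}
    (hnm : n ≠ m) :
    (L : ℝ)⁻¹ * ((channelLaw R).real (errorEvent u M P₁ P₂ dec n) +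
      (channelLaw R).real (errorEvent u M P₁ P₂ dec m)) ≤ blockErrorProb u M P₁ P₂ dec := by
  rw [blockErrorProb, one_div,
    ← Finset.sum_pair (f := fun k => (channelLaw R).real (errorEvent u M P₁ P₂ dec k)) hnm]
  gcongr
  exact Finset.sum_le_sum_of_subset_of_nonneg (Finset.subset_univ _)
    fun _ _ _ => measureReal_nonneg

theorem exists_mul_le_blockErrorProb (hnm : n ≠ m) (hz : ‖z‖ = 1) (hbp : b p = 1)
    (hb : ∀ j, ‖b j‖ ≤ 1) (C : ℝ) :
    ∃ c, 0 < c ∧ ∀ (P₁ P₂ ρ δ : ℝ) (dec : (Fin R → ℂ) → (Slot R → ℂ) → Fin L), 0 ≤ P₁ →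
      (Measurable fun x : (Fin R → ℂ) × (Slot R → ℂ) => dec x.1 x.2) →
      0 ≤ ρ → ρ ≤ 1 → 0 ≤ δ → δ ≤ 1 →
      (∀ x ∈ tube p b ρ δ,
        ‖(codeword u M n - z • codeword u M m) *ᵥ ((gain R P₁ P₂ : ℂ) • x)‖ ≤ C) →
      c * (ρ ^ 2 * (δ ^ 2) ^ (R - 1)) ≤ blockErrorProb u M P₁ P₂ dec := by
  have hL : (0 : ℝ) < L := mod_cast n.pos
  have hβ : 0 < (Measure.pi fun _ : Fin R => cscg).real (closedBall (fun _ => 3 / 2) (1 / 2)) :=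
    ENNReal.toReal_pos pi_cscg_closedBall_ne_zero (measure_ne_top _ _)
  set β := (Measure.pi fun _ : Fin R => cscg).real (closedBall (fun _ => 3 / 2) (1 / 2))
  refine ⟨(L : ℝ)⁻¹ * (β * (Real.exp (-3 ^ 2) ^ R * (1 / 4 * (1 / 4) ^ (R - 1)) *
    Real.exp (-(C + 1) ^ 2) ^ Fintype.card (Slot R))), by positivity, ?_⟩
  intro P₁ P₂ ρ δ dec h₁ hdec hρ₀ hρ₁ hδ₀ hδ₁ hC
  have hpair := ENNReal.toReal_mono (by finiteness)
    (le_channelLaw_errorEvent_add h₁ hdec hnm hz hbp hb hρ₀ hρ₁ hδ₀ hδ₁ hC)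
  rw [ENNReal.toReal_add (by finiteness) (by finiteness), ENNReal.toReal_mul, ENNReal.toReal_mul,
    ENNReal.toReal_ofReal (by positivity), ENNReal.toReal_ofReal (by positivity)] at hpair
  calc _ = (L : ℝ)⁻¹ * (β * (Real.exp (-3 ^ 2) ^ R * ((ρ / 2) ^ 2 * ((δ / 2) ^ 2) ^ (R - 1)) *
        Real.exp (-(C + 1) ^ 2) ^ Fintype.card (Slot R))) := by
        have hδ : ((δ / 2) ^ 2) ^ (R - 1) = (1 / 4) ^ (R - 1) * (δ ^ 2) ^ (R - 1) := by
          rw [← mul_pow]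
          ring
        rw [hδ]
        ring
    _ ≤ _ := mul_le_mul_of_nonneg_left hpair (by positivity)
    _ ≤ _ := inv_mul_add_le_blockErrorProb hnm

theorem norm_mulVec_le_of_mem_tube {ι : Type*} [Fintype ι] {S : Matrix ι (Fin R) ℂ} {ρ δ : ℝ}
    (hδ : 0 ≤ δ) {x : Fin R → ℂ} (hx : x ∈ tube p b ρ δ) :
    ‖S *ᵥ x‖ ≤ ‖S‖ * δ + ρ * ‖S *ᵥ b‖ := by
  have hdist : ‖x - x p • b‖ ≤ δ := (pi_norm_le_iff_of_nonneg hδ).2 fun j => by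
    rw [Pi.sub_apply, Pi.smul_apply, smul_eq_mul, mul_comm]
    exact hx.2 j
  calc ‖S *ᵥ x‖ = ‖S *ᵥ (x - x p • b) + x p • S *ᵥ b‖ := by
        rw [mulVec_sub, mulVec_smul, sub_add_cancel]
    _ ≤ ‖S *ᵥ (x - x p • b)‖ + ‖x p • S *ᵥ b‖ := norm_add_le _ _
    _ ≤ ‖S‖ * δ + ρ * ‖S *ᵥ b‖ := by
        rw [norm_smul]
        gcongr
        · exact (linfty_opNorm_mulVec S _).trans (by gcongr)
        · exact hx.1

theorem gain_mul_inv_sqrt_le {P : ℝ} (hR : R ≠ 0) (hα₀ : 0 ≤ α) (hα₁ : α ≤ 1) (hP : 0 < P) :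
    gain R (α * P) ((1 - α) * P / R) * (√P)⁻¹ ≤ 2 := by
  have := sub_nonneg.2 hα₁
  rw [← div_eq_mul_inv, div_le_iff₀ (Real.sqrt_pos.2 hP), ← sq_le_sq₀ gain_nonneg (by positivity),
    gain_sq hR hα₀ hα₁ hP.le, mul_pow, Real.sq_sqrt hP.le]
  have hfrac : α * P / (1 + α * P) ≤ 1 := div_le_one_of_le₀ (by linarith) (by positivity)
  calc 2 * (1 - α) * P * (α * P / (1 + α * P)) ≤ 2 * 1 * P * 1 := by
        gcongr
        linarith
    _ ≤ 2 ^ 2 * P := by linarith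

variable {dec : ℝ → (Fin R → ℂ) → (Slot R → ℂ) → Fin L}

theorem isBigO_blockErrorProb (hα₀ : 0 ≤ α) (hα₁ : α ≤ 1)
    (hdec : ∀ᶠ P in atTop, Measurable fun x : (Fin R → ℂ) × (Slot R → ℂ) => dec P x.1 x.2)
    (hnm : n ≠ m) (hz : ‖z‖ = 1) (hbp : b p = 1) (hb : ∀ j, ‖b j‖ ≤ 1) {ρ : ℝ → ℝ}
    (hρ : ∀ᶠ P in atTop, ρ P ∈ Set.Icc 0 1) {C : ℝ}
    (hC : ∀ᶠ P in atTop, gain R (α * P) ((1 - α) * P / R) *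
      (ρ P * ‖(codeword u M n - z • codeword u M m) *ᵥ b‖) ≤ C) :
    (fun P => ρ P ^ 2 * P⁻¹ ^ (R - 1)) =O[atTop]
      fun P => blockErrorProb u M (α * P) ((1 - α) * P / R) (dec P) := by
  set S := codeword u M n - z • codeword u M m
  obtain ⟨c, hc, hle⟩ :=
    exists_mul_le_blockErrorProb (u := u) (M := M) hnm hz hbp hb (‖S‖ * 2 + C)
  refine IsBigO.of_bound c⁻¹ ?_
  filter_upwards [hdec, hρ, hC, eventually_ge_atTop 1] with P hdecP hρP hCP hP
  have hP₀ : 0 < P := one_pos.trans_le hP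
  have hδ : (√P)⁻¹ ≤ 1 := inv_le_one_of_one_le₀ (Real.one_le_sqrt.2 hP)
  have hmean : ∀ x ∈ tube p b (ρ P) (√P)⁻¹,
      ‖S *ᵥ ((gain R (α * P) ((1 - α) * P / R) : ℂ) • x)‖ ≤ ‖S‖ * 2 + C := fun x hx => by
    rw [mulVec_smul, norm_smul, Complex.norm_of_nonneg gain_nonneg]
    calc _ ≤ gain R (α * P) ((1 - α) * P / R) * (‖S‖ * (√P)⁻¹ + ρ P * ‖S *ᵥ b‖) :=
          mul_le_mul_of_nonneg_left (norm_mulVec_le_of_mem_tube (by positivity) hx) gain_nonneg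
      _ = ‖S‖ * (gain R (α * P) ((1 - α) * P / R) * (√P)⁻¹) +
            gain R (α * P) ((1 - α) * P / R) * (ρ P * ‖S *ᵥ b‖) := by ring
      _ ≤ ‖S‖ * 2 + C := by
          gcongr
          exact gain_mul_inv_sqrt_le p.pos.ne' hα₀ hα₁ hP₀
  have hbound := hle _ _ _ _ _ (by positivity) hdecP hρP.1 hρP.2 (by positivity) hδ hmean
  rw [inv_pow, Real.sq_sqrt hP₀.le] at hbound
  rw [Real.norm_of_nonneg blockErrorProb_nonneg, Real.norm_of_nonneg (by positivity)]
  exact (le_inv_mul_iff₀ hc).2 hbound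

theorem rpow_neg_isBigO_blockErrorProb (hR : R ≠ 0) (hL : 2 ≤ L) (hα₀ : 0 ≤ α) (hα₁ : α ≤ 1)
    (hdec : ∀ᶠ P in atTop, Measurable fun x : (Fin R → ℂ) × (Slot R → ℂ) => dec P x.1 x.2) :
    (fun P : ℝ => P ^ (-(R : ℝ))) =O[atTop]
      fun P => blockErrorProb u M (α * P) ((1 - α) * P / R) (dec P) := by
  have : Nontrivial (Fin L) := Fin.nontrivial_iff_two_le.2 hL
  obtain ⟨n, m, hnm⟩ := exists_pair_ne (Fin L)
  let p : Fin R := ⟨0, Nat.pos_of_ne_zero hR⟩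
  have hb : ∀ j, ‖(Pi.single p 1 : Fin R → ℂ) j‖ ≤ 1 := fun j =>
    (norm_le_pi_norm _ j).trans_eq (by rw [Pi.norm_single, norm_one])
  have hρ : ∀ᶠ P in atTop, (√P)⁻¹ ∈ Set.Icc 0 1 := by
    filter_upwards [eventually_ge_atTop 1] with P hP
    exact ⟨by positivity, inv_le_one_of_one_le₀ (Real.one_le_sqrt.2 hP)⟩
  have hC : ∀ᶠ P in atTop, gain R (α * P) ((1 - α) * P / R) * ((√P)⁻¹ *
      ‖(codeword u M n - (1 : ℂ) • codeword u M m) *ᵥ Pi.single p 1‖) ≤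
        2 * ‖(codeword u M n - (1 : ℂ) • codeword u M m) *ᵥ Pi.single p 1‖ := by
    filter_upwards [eventually_gt_atTop 0] with P hP
    rw [← mul_assoc]
    gcongr
    exact gain_mul_inv_sqrt_le hR hα₀ hα₁ hP
  refine IsBigO.congr' (isBigO_blockErrorProb hα₀ hα₁ hdec hnm norm_one (Pi.single_eq_same p 1) hb
    hρ hC) ?_ EventuallyEq.rfl
  filter_upwards [eventually_gt_atTop 0] with P hP
  rw [inv_pow, Real.sq_sqrt hP.le, mul_pow_sub_one hR, Real.rpow_neg hP.le, Real.rpow_natCast,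
    inv_pow]

theorem rpow_neg_sub_one_isBigO_blockErrorProb (hα₀ : 0 ≤ α) (hα₁ : α ≤ 1)
    (hdec : ∀ᶠ P in atTop, Measurable fun x : (Fin R → ℂ) × (Slot R → ℂ) => dec P x.1 x.2)
    (hnm : n ≠ m) (hz : ‖z‖ = 1) {a : Fin R → ℂ} (ha : a ≠ 0)
    (hcollision : codeword u M n *ᵥ a = z • codeword u M m *ᵥ a) :
    (fun P : ℝ => P ^ (-((R : ℝ) - 1))) =O[atTop]
      fun P => blockErrorProb u M (α * P) ((1 - α) * P / R) (dec P) := by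
  obtain ⟨q, hq⟩ := Function.ne_iff.1 ha
  have : Nonempty (Fin R) := ⟨q⟩
  obtain ⟨p, hp⟩ := Finite.exists_max fun j => ‖a j‖
  have hap : 0 < ‖a p‖ := (norm_pos_iff.2 hq).trans_le (hp q)
  have hb : ∀ j, ‖((a p)⁻¹ • a) j‖ ≤ 1 := fun j => by
    rw [Pi.smul_apply, norm_smul, norm_inv]
    exact inv_mul_le_one_of_le₀ (hp j) hap.le
  have hker : (codeword u M n - z • codeword u M m) *ᵥ ((a p)⁻¹ • a) = 0 := by
    rw [mulVec_smul, sub_mulVec, smul_mulVec, hcollision, sub_self, smul_zero]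
  refine IsBigO.congr' (isBigO_blockErrorProb (ρ := fun _ => 1) hα₀ hα₁ hdec hnm hz
    (inv_mul_cancel₀ (norm_pos_iff.1 hap)) hb (.of_forall fun _ => ⟨zero_le_one, le_rfl⟩)
    (C := 0) (.of_forall fun _ => ?_)) ?_ EventuallyEq.rfl
  · rw [hker, norm_zero, mul_zero, mul_zero]
  · filter_upwards [eventually_gt_atTop 0] with P hP
    rw [one_pow, one_mul, Real.rpow_neg hP.le, ← Nat.cast_pred p.pos, Real.rpow_natCast, inv_pow]

end PairwiseLowerBound

/-! ### The diversity order of the network -/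

section Diversity

variable {R L : ℕ} {u : Slot R → ℤ} {M : Matrix (Fin R) (Fin R) ℂ} {α : ℝ}
  {dec : ℝ → (Fin R → ℂ) → (Slot R → ℂ) → Fin L}

theorem IsGBH.det_ne_zero (hR : R ≠ 0) (hM : IsGBH M) : M.det ≠ 0 := by
  refine fun hdet => pow_ne_zero R (Nat.cast_ne_zero (R := ℂ).2 hR) ?_
  have := congrArg Matrix.det hM.mul_conjTranspose
  rwa [Matrix.det_mul, hdet, zero_mul, Matrix.det_smul, Matrix.det_one, mul_one, Fintype.card_fin,
    eq_comm] at this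

theorem hasDiversityOrder_of_forall_det_ne_zero (hR : R ≠ 0) (hL : 2 ≤ L) (hα₀ : 0 < α)
    (hα₁ : α < 1) (hdet : ∀ n m : Fin L, n ≠ m →
      (Matrix.fromCols (codeword u M n) (codeword u M m)).det ≠ 0)
    (hdec : ∀ᶠ P in atTop, IsMLDecoder u M (α * P) ((1 - α) * P / R) (dec P)) :
    HasDiversityOrder (fun P => blockErrorProb u M (α * P) ((1 - α) * P / R) (dec P)) R := by
  have hR' : (0 : ℝ) < R := mod_cast Nat.pos_of_ne_zero hR
  refine hasDiversityOrder_of_isBigO (rpow_neg_isBigO_blockErrorProb hR hL hα₀.le hα₁.le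
    (hdec.mono fun _ h => h.measurable)) fun b hb => ?_
  have hs : max (b / R) 0 < 1 := max_lt ((div_lt_one hR').2 hb) one_pos
  refine (blockErrorProb_isBigO_rpow_neg hR hα₀ hα₁ hdet hdec (le_max_right _ _) hs).trans
    (IsBigO.of_bound' ?_)
  filter_upwards [eventually_ge_atTop 1] with P hP
  have : 0 ≤ P := zero_le_one.trans hP
  rw [Real.norm_of_nonneg (by positivity), Real.norm_of_nonneg (by positivity)]
  exact Real.rpow_le_rpow_of_exponent_le hP
    (neg_le_neg ((div_le_iff₀ hR').1 (le_max_left (b / R) 0)))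

theorem gcd_eq_one_of_hasDiversityOrder (hL : L ≠ 0) (hM : M.det ≠ 0) (hα₀ : 0 ≤ α) (hα₁ : α ≤ 1)
    (hdec : ∀ᶠ P in atTop, Measurable fun x : (Fin R → ℂ) × (Slot R → ℂ) => dec P x.1 x.2)
    (hdiv : HasDiversityOrder (fun P => blockErrorProb u M (α * P) ((1 - α) * P / R) (dec P)) R)
    (i : Fin R) : Int.gcd (u (.inl i) - u (.inr i)) L = 1 := by
  refine (gcd_eq_one_iff_forall_not_dvd hL).2 fun n m hnm hdvd => ?_
  obtain ⟨a, ha, z, hz, hcollision⟩ := exists_codeword_mulVec_eq hM hdvd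
  have := hdiv.le_of_isBigO
    (rpow_neg_sub_one_isBigO_blockErrorProb hα₀ hα₁ hdec hnm hz ha hcollision)
  linarith

end Diversity

end

end RelayNetwork

theorem mainTheorem3_general {R L : ℕ} (hR : 1 ≤ R) (hL : 2 ≤ L) (u : RelayNetwork.Slot R → ℤ)
    {M : Matrix (Fin R) (Fin R) ℂ} (hM : M.det ≠ 0) {α : ℝ} (hα₀ : 0 < α) (hα₁ : α < 1)
    {dec : ℝ → (Fin R → ℂ) → (RelayNetwork.Slot R → ℂ) → Fin L}
    (hdec : ∀ᶠ P in Filter.atTop,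
      RelayNetwork.IsMLDecoder u M (α * P) ((1 - α) * P / R) (dec P)) :
    (RelayNetwork.HasDiversityOrder
        (fun P => RelayNetwork.blockErrorProb u M (α * P) ((1 - α) * P / R) (dec P)) R ↔
      ∀ i : Fin R, Int.gcd (u (Sum.inl i) - u (Sum.inr i)) (L : ℤ) = 1) ∧
    (RelayNetwork.MeetsDeterminantCriterion
        (fun k : Fin L => RelayNetwork.codeword u M k) ↔
      ∀ i : Fin R, Int.gcd (u (Sum.inl i) - u (Sum.inr i)) (L : ℤ) = 1) := by
  have hR₀ : R ≠ 0 := Nat.one_le_iff_ne_zero.1 hR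
  have hL₀ : L ≠ 0 := (two_pos.trans_le hL).ne'
  refine ⟨⟨fun hdiv => ?_, fun hgcd => ?_⟩,
    RelayNetwork.meetsDeterminantCriterion_codeword_iff hR hL₀ hM⟩
  · exact RelayNetwork.gcd_eq_one_of_hasDiversityOrder hL₀ hM hα₀.le hα₁.le
      (hdec.mono fun _ h => h.measurable) hdiv
  · refine RelayNetwork.hasDiversityOrder_of_forall_det_ne_zero hR₀ hL hα₀ hα₁
      (fun n m hnm => ?_) hdec
    exact (RelayNetwork.det_fromCols_codeword_ne_zero_iff hR hM n m).2 fun i =>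
      (RelayNetwork.gcd_eq_one_iff_forall_not_dvd hL₀).1 (hgcd i) n m hnm

/-- For a network with `R` relays that uses the cyclic code with generator `D`, with total power
`P = P₁ + R P₂` split in fixed proportions and a maximum likelihood decoder, the diversity order
is `R`, equivalently the determinant criterion holds, if and only if
`gcd (u_i - u_{R+i}, L) = 1` for each `i`. -/
theorem mainTheorem3 (R L : ℕ) (hR : 1 ≤ R) (hL : 2 ≤ L)
    (u : RelayNetwork.Slot R → ℤ)
    (M : Matrix (Fin R) (Fin R) ℂ) (hM : RelayNetwork.IsGBH M)
    (α : ℝ) (hα₀ : 0 < α) (hα₁ : α < 1)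
    (dec : ℝ → (Fin R → ℂ) → (RelayNetwork.Slot R → ℂ) → Fin L)
    (hdec : ∀ P : ℝ, 0 < P →
      RelayNetwork.IsMLDecoder u M (α * P) ((1 - α) * P / R) (dec P)) :
    (RelayNetwork.HasDiversityOrder
        (fun P => RelayNetwork.blockErrorProb u M (α * P) ((1 - α) * P / R) (dec P)) R ↔
      ∀ i : Fin R, Int.gcd (u (Sum.inl i) - u (Sum.inr i)) (L : ℤ) = 1) ∧
    (RelayNetwork.MeetsDeterminantCriterion
        (fun k : Fin L => RelayNetwork.codeword u M k) ↔
      ∀ i : Fin R, Int.gcd (u (Sum.inl i) - u (Sum.inr i)) (L : ℤ) = 1) := by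
  exact mainTheorem3_general hR hL u (hM.det_ne_zero (Nat.one_le_iff_ne_zero.1 hR)) hα₀ hα₁
    ((Filter.eventually_gt_atTop 0).mono hdec)
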